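/- Let $n\ge 3$. Consider $n$ points $p_1=0,p_2,\dots,p_n\in\mathbb R^2$, not all equal, up to rescaling and orthogonal transformations, i.e. the configuration space $$C_n(\mathbb R^2)=P\big((\mathbb R^2)^{n-1}\big)/O(2,\mathbb R),$$ and the map $C_n(\mathbb R^2)\to P_{\binom n2-1}(\mathbb C)$, $(p_i)\mapsto(|p_i-p_j|^2)_{1\le i<j\le n}$. The complex Cayley–Menger variety $CM_{2n-4}(\mathbb C)\subset P_{\binom n2-1}(\mathbb C)$ is the Zariski closure of the image of this map, that is, the common zero locus of all homogeneous complex polynomials vanishing on the image. Let $$\Phi:P_{n-2}(\mathbb C)\times P_{n-2}(\mathbb C)\to P_{\binom n2-1}(\mathbb C),\qquad \big((u_2:\dots:u_n),(v_2:\dots:v_n)\big)\mapsto\big((u_iv_i)_{2\le i\le n},\ ((u_i-u_j)(v_i-v_j))_{2\le i<j\le n}\big),$$ which is everywhere defined. Then: 1. $CM_{2n-4}(\mathbb C)$ is exactly the image of $\Phi$. 2. The map $\pi:P_{n-2}(\mathbb C)^2\to CM_{2n-4}(\mathbb C)$ defined by $\Phi$ is a double covering branched along the diagonal $\Delta=\{(w,w)\}$.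 That is, in the classical topology $\pi$ is a proper surjection; over the complement of $\pi(\Delta)$ it is a covering map all of whose fibres have exactly two points; for $x\in\Delta$ the fibre through $x$ is $\{x\}$ and $\pi$ is not injective on any neighbourhood of $x$. Moreover, the holomorphic differential of $\Phi$ at $x\in P_{n-2}(\mathbb C)^2$ is injective if and only if $x\notin\Delta$. 3. $\pi$ identifies $CM_{2n-4}(\mathbb C)$ with the quotient $P_{n-2}(\mathbb C)^2/\mathbb Z_2$ by the involution $(u,v)\mapsto(v,u)$: the induced map $P_{n-2}(\mathbb C)^2/\mathbb Z_2\to CM_{2n-4}(\mathbb C)$ is a homeomorphism for the classical topologies and an isomorphism of algebraic varieties, i.e. a homeomorphism for the Zariski topologies such that a function on a Zariski open subset $U\subset CM_{2n-4}(\mathbb C)$ is regular if and only if its pull-back to $\pi^{-1}(U)$ is regular. -/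

import Mathlib

open scoped LinearAlgebra.Projectivization Topology

noncomputable section

namespace CayleyMenger

/-! ### The map `(u, v) ↦ (u_i v_i, (u_i - u_j)(v_i - v_j))`

A configuration of `n` points is normalised by putting its first point at the origin; the
remaining `n - 1` points are indexed by `Fin (n - 1)`. -/

/-- Index set of the `n.choose 2` pairs among `n` points: `inl i` is the pair formed by the first
point (the origin) and the point `i`; `inr (i, j)`, with `i < j`, is the pair of points `i, j`. -/
abbrev PairIdx (n : ℕ) : Type :=
  Fin (n - 1) ⊕ {p : Fin (n - 1) × Fin (n - 1) // p.1 < p.2}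

/-- The complex projective space `P_{n-2}(ℂ)`. -/
abbrev ProjSource (n : ℕ) : Type := ℙ ℂ (Fin (n - 1) → ℂ)

/-- The complex projective space of dimension `n.choose 2 - 1`. -/
abbrev ProjTarget (n : ℕ) : Type := ℙ ℂ (PairIdx n → ℂ)

/-- The vector with coordinates `u_i v_i` and `(u_i - u_j)(v_i - v_j)`, `i < j`. -/
def pairing (n : ℕ) (u v : Fin (n - 1) → ℂ) : PairIdx n → ℂ :=
  Sum.elim (fun i => u i * v i)
    (fun p => (u p.1.1 - u p.1.2) * (v p.1.1 - v p.1.2))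

theorem pairing_ne_zero {n : ℕ} {u v : Fin (n - 1) → ℂ} (hu : u ≠ 0) (hv : v ≠ 0) :
    pairing n u v ≠ 0 := by
  intro h
  obtain ⟨i, hi⟩ := Function.ne_iff.mp hu
  obtain ⟨j, hj⟩ := Function.ne_iff.mp hv
  simp only [Pi.zero_apply, ne_eq] at hi hj
  have hl : ∀ k, u k * v k = 0 := fun k => by
    simpa [pairing] using congrFun h (Sum.inl k)
  have hr : ∀ k l : Fin (n - 1), k < l → (u k - u l) * (v k - v l) = 0 := fun k l hkl => by
    have := congrFun h (Sum.inr ⟨(k, l), hkl⟩)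
    simpa only [pairing, Sum.elim_inr, Pi.zero_apply] using this
  have hvi : v i = 0 := (mul_eq_zero.mp (hl i)).resolve_left hi
  have huj : u j = 0 := (mul_eq_zero.mp (hl j)).resolve_right hj
  rcases lt_trichotomy i j with hij | hij | hij
  · have := hr i j hij
    simp [hvi, huj, hi, hj] at this
  · exact hj (hij ▸ hvi)
  · have := hr j i hij
    simp [hvi, huj, hi, hj] at this

theorem pairing_smul_smul {n : ℕ} (a b : ℂ) (u v : Fin (n - 1) → ℂ) :
    pairing n (a • u) (b • v) = (a * b) • pairing n u v := by
  funext k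
  rcases k with i | p
  · simp [pairing]; ring
  · simp [pairing]; ring

/-- The map `P_{n-2}(ℂ)² → P_{n.choose 2 - 1}(ℂ)`,
`([u], [v]) ↦ [u_i v_i : (u_i - u_j)(v_i - v_j)]`. -/
def cmMap (n : ℕ) (x : ProjSource n × ProjSource n) : ProjTarget n :=
  Projectivization.lift
    (fun u : {u : Fin (n - 1) → ℂ // u ≠ 0} =>
      Projectivization.lift
        (fun v : {v : Fin (n - 1) → ℂ // v ≠ 0} =>
          Projectivization.mk ℂ (pairing n u.1 v.1) (pairing_ne_zero u.2 v.2))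
        (by
          intro v w t hvw
          rw [Projectivization.mk_eq_mk_iff']
          refine ⟨t, ?_⟩
          have := pairing_smul_smul 1 t u.1 w.1
          rw [one_smul, one_mul] at this
          rw [hvw, this])
        x.2)
    (by
      intro u w t huw
      induction x.2 using Projectivization.ind with
      | h v hv =>
        simp only [Projectivization.lift_mk]
        rw [Projectivization.mk_eq_mk_iff']
        refine ⟨t, ?_⟩
        have := pairing_smul_smul t 1 w.1 v
        rw [one_smul, mul_one] at this
        rw [huw, this])
    x.1

theorem cmMap_mk {n : ℕ} (u v : Fin (n - 1) → ℂ) (hu : u ≠ 0) (hv : v ≠ 0) :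
    cmMap n (Projectivization.mk ℂ u hu, Projectivization.mk ℂ v hv) =
      Projectivization.mk ℂ (pairing n u v) (pairing_ne_zero hu hv) := rfl

/-! ### The configuration space of `n` points in the plane and its squared distances -/

/-- The Euclidean plane. -/
abbrev Plane : Type := EuclideanSpace ℝ (Fin 2)

/-- The projective space `P((ℝ²)^(n-1))`: configurations of `n` points in the plane, not all equal,
up to translation and (signed) rescaling. -/
abbrev ScaledConfig (n : ℕ) : Type := ℙ ℝ (Fin (n - 1) → Plane)

/-- The diagonal action of an orthogonal transformation of the plane on `P((ℝ²)^(n-1))`. -/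
def orthAct (n : ℕ) (g : Plane ≃ₗᵢ[ℝ] Plane) : ScaledConfig n → ScaledConfig n :=
  Projectivization.map
    (LinearEquiv.piCongrRight fun _ : Fin (n - 1) => g.toLinearEquiv).toLinearMap
    (LinearEquiv.piCongrRight fun _ : Fin (n - 1) => g.toLinearEquiv).injective

theorem orthAct_mk {n : ℕ} (g : Plane ≃ₗᵢ[ℝ] Plane) (z : Fin (n - 1) → Plane) (hz : z ≠ 0)
    (hgz : (fun i => g (z i)) ≠ 0) :
    orthAct n g (Projectivization.mk ℝ z hz) = Projectivization.mk ℝ (fun i => g (z i)) hgz := rfl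

/-- Equivalence under the orthogonal group `O(2, ℝ)`. -/
def configSetoid (n : ℕ) : Setoid (ScaledConfig n) where
  r x y := ∃ g : Plane ≃ₗᵢ[ℝ] Plane, orthAct n g x = y
  iseqv :=
    { refl := fun x => ⟨LinearIsometryEquiv.refl ℝ Plane, by
        induction x using Projectivization.ind with
        | h z hz => rfl⟩
      symm := by
        rintro x _ ⟨g, rfl⟩
        refine ⟨g.symm, ?_⟩
        induction x using Projectivization.ind with
        | h z hz =>
          simp [orthAct, Projectivization.map_mk, Projectivization.mk_eq_mk_iff']
          exact ⟨1, by funext i; simp⟩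
      trans := by
        rintro x _ _ ⟨g, rfl⟩ ⟨h, rfl⟩
        refine ⟨g.trans h, ?_⟩
        induction x using Projectivization.ind with
        | h z hz => rfl }

/-- The configuration space `C_n(ℝ²) = P((ℝ²)^(n-1)) / O(2, ℝ)`. -/
def ConfigSpace (n : ℕ) : Type := Quotient (configSetoid n)

/-- The squared mutual distances of the configuration `0, z_2, …, z_n`, as complex numbers. -/
def sqDist (n : ℕ) (z : Fin (n - 1) → Plane) : PairIdx n → ℂ :=
  Sum.elim (fun i => ((dist (z i) 0 ^ 2 : ℝ) : ℂ))
    (fun p => ((dist (z p.1.1) (z p.1.2) ^ 2 : ℝ) : ℂ))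

theorem sqDist_ne_zero {n : ℕ} {z : Fin (n - 1) → Plane} (hz : z ≠ 0) : sqDist n z ≠ 0 := by
  intro h
  apply hz
  funext i
  have := congrFun h (Sum.inl i)
  simpa [sqDist] using this

theorem sqDist_smul {n : ℕ} (t : ℝ) (z : Fin (n - 1) → Plane) :
    sqDist n (t • z) = ((t ^ 2 : ℝ) : ℂ) • sqDist n z := by
  funext k
  rcases k with i | p
  · simp [sqDist, norm_smul, mul_pow]
  · simp [sqDist, dist_smul₀, mul_pow]

theorem sqDist_isometry {n : ℕ} (g : Plane ≃ₗᵢ[ℝ] Plane) (z : Fin (n - 1) → Plane) :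
    sqDist n (fun i => g (z i)) = sqDist n z := by
  funext k
  rcases k with i | p
  · simp [sqDist]
  · simp [sqDist]

/-- The map `P((ℝ²)^(n-1)) → P_{n.choose 2 - 1}(ℂ)` given by the squared mutual distances. -/
def scaledDistMap (n : ℕ) : ScaledConfig n → ProjTarget n :=
  Projectivization.lift
    (fun z : {z : Fin (n - 1) → Plane // z ≠ 0} =>
      Projectivization.mk ℂ (sqDist n z.1) (sqDist_ne_zero z.2))
    (by
      intro z w t hzw
      rw [Projectivization.mk_eq_mk_iff']
      exact ⟨((t ^ 2 : ℝ) : ℂ), by rw [hzw, sqDist_smul]⟩)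

/-- The natural map `C_n(ℝ²) → P_{n.choose 2 - 1}(ℂ)`, `(p_i) ↦ (|p_i - p_j|²)`. -/
def distMap (n : ℕ) : ConfigSpace n → ProjTarget n :=
  Quotient.lift (scaledDistMap n) (by
    rintro x _ ⟨g, rfl⟩
    induction x using Projectivization.ind with
    | h z hz =>
      simp only [orthAct, Projectivization.map_mk, scaledDistMap, Projectivization.lift_mk]
      rw [Projectivization.mk_eq_mk_iff']
      exact ⟨1, by rw [one_smul]; exact sqDist_isometry g z⟩)

/-! ### Zariski closure and the Cayley–Menger variety -/

/-- The Zariski closure of a subset of a projective space: the common vanishing locus of all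
homogeneous polynomials that vanish on it. Vanishing of a homogeneous polynomial at a point does
not depend on the representative. -/
def zariskiClosure {ι : Type} (S : Set (ℙ ℂ (ι → ℂ))) : Set (ℙ ℂ (ι → ℂ)) :=
  {x | ∀ (F : MvPolynomial ι ℂ) (d : ℕ), F.IsHomogeneous d →
    (∀ y ∈ S, MvPolynomial.eval y.rep F = 0) → MvPolynomial.eval x.rep F = 0}

/-- The complex Cayley–Menger variety `CM_{2n-4}(ℂ)`: the Zariski closure of the image of the
configuration space `C_n(ℝ²)`. -/
def cmVariety (n : ℕ) : Set (ProjTarget n) := zariskiClosure (Set.range (distMap n))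

/-! ### Topologies and regular functions -/

/-- The classical topology of a complex projective space: the quotient topology from the nonzero
vectors. -/
instance classicalTopology {ι : Type} : TopologicalSpace (ℙ ℂ (ι → ℂ)) :=
  TopologicalSpace.coinduced (Projectivization.mk' ℂ) inferInstance

/-- The Zariski topology of a projective space, generated by the nonvanishing loci of homogeneous
polynomials. -/
@[reducible]
def zariskiTopology (ι : Type) : TopologicalSpace (ℙ ℂ (ι → ℂ)) :=
  TopologicalSpace.generateFrom
    {U | ∃ (F : MvPolynomial ι ℂ) (d : ℕ), F.IsHomogeneous d ∧
      U = {x | MvPolynomial.eval x.rep F ≠ 0}}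

/-- A polynomial in two groups of variables that is bihomogeneous of bidegree `d`. -/
def IsBihomogeneous {ι : Type} (F : MvPolynomial (ι ⊕ ι) ℂ) (d : ℕ × ℕ) : Prop :=
  F.IsWeightedHomogeneous (Sum.elim (fun _ => ((1, 0) : ℕ × ℕ)) (fun _ => (0, 1))) d

/-- Evaluation of a polynomial in two groups of variables at representatives of a pair of points. -/
def evalPair {ι : Type} (F : MvPolynomial (ι ⊕ ι) ℂ) (x : ℙ ℂ (ι → ℂ) × ℙ ℂ (ι → ℂ)) : ℂ :=
  MvPolynomial.eval (Sum.elim x.1.rep x.2.rep) F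

/-- The Zariski topology of the variety `P × P` (finer than the product of the Zariski topologies),
generated by the nonvanishing loci of bihomogeneous polynomials. -/
@[reducible]
def zariskiTopologyProd (ι : Type) : TopologicalSpace (ℙ ℂ (ι → ℂ) × ℙ ℂ (ι → ℂ)) :=
  TopologicalSpace.generateFrom
    {U | ∃ (F : MvPolynomial (ι ⊕ ι) ℂ) (d : ℕ × ℕ), IsBihomogeneous F d ∧
      U = {x | evalPair F x ≠ 0}}

/-- `f` is regular on the subset `U` of `Y ⊆ P` (meant for `U` Zariski open in `Y`): near each point
of `U` it is a quotient of homogeneous polynomials of equal degree. The nonvanishing loci of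
homogeneous polynomials being a basis of the topology, one may take as neighbourhood the part of
`U` where the denominator does not vanish. -/
def IsRegularOn {ι : Type} {Y : Set (ℙ ℂ (ι → ℂ))} (U : Set Y) (f : Y → ℂ) : Prop :=
  ∀ x ∈ U, ∃ (d : ℕ) (F G : MvPolynomial ι ℂ), F.IsHomogeneous d ∧ G.IsHomogeneous d ∧
    MvPolynomial.eval x.1.rep G ≠ 0 ∧
    ∀ y ∈ U, MvPolynomial.eval y.1.rep G ≠ 0 →
      f y = MvPolynomial.eval y.1.rep F / MvPolynomial.eval y.1.rep G

/-- `f` is regular on the subset `U` of `P × P` (meant for `U` Zariski open): near each point of `U`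
it is a quotient of bihomogeneous polynomials of equal bidegree. -/
def IsRegularOnProd {ι : Type} (U : Set (ℙ ℂ (ι → ℂ) × ℙ ℂ (ι → ℂ)))
    (f : ℙ ℂ (ι → ℂ) × ℙ ℂ (ι → ℂ) → ℂ) : Prop :=
  ∀ x ∈ U, ∃ (d : ℕ × ℕ) (F G : MvPolynomial (ι ⊕ ι) ℂ),
    IsBihomogeneous F d ∧ IsBihomogeneous G d ∧ evalPair G x ≠ 0 ∧
    ∀ y ∈ U, evalPair G y ≠ 0 → f y = evalPair F y / evalPair G y

/-! ### The quotient of `X × X` by the exchange of the factors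

As a set it is `Sym2 X`. -/

/-- The quotient map `X × X → (X × X) / Z₂`. -/
def toSym2 {X : Type} (x : X × X) : Sym2 X := s(x.1, x.2)

/-- The quotient topology on `(X × X) / Z₂`, for a given topology on `X × X`. -/
@[reducible]
def quotTopology {X : Type} (t : TopologicalSpace (X × X)) : TopologicalSpace (Sym2 X) :=
  TopologicalSpace.coinduced toSym2 t

/-- Regular functions on the quotient variety `(P × P) / Z₂`: those whose pull-back to `P × P` is
regular. -/
def IsRegularOnQuot {ι : Type} (U : Set (Sym2 (ℙ ℂ (ι → ℂ)))) (f : Sym2 (ℙ ℂ (ι → ℂ)) → ℂ) : Prop :=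
  IsRegularOnProd (toSym2 ⁻¹' U) (f ∘ toSym2)

/-- `e` is an isomorphism of the quotient variety `(P × P) / Z₂` onto the subvariety `Y` of a
projective space: a homeomorphism for the Zariski topologies that identifies the regular functions
on every open set. -/
structure IsIsoOfVarieties {ι κ : Type} {Y : Set (ℙ ℂ (κ → ℂ))}
    (e : Sym2 (ℙ ℂ (ι → ℂ)) → Y) : Prop where
  homeo : @IsHomeomorph _ _ (quotTopology (zariskiTopologyProd ι))
    (TopologicalSpace.induced Subtype.val (zariskiTopology κ)) e
  regular_iff : ∀ U : Set Y,
    IsOpen[TopologicalSpace.induced Subtype.val (zariskiTopology κ)] U →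
      ∀ f : Y → ℂ, IsRegularOn U f ↔ IsRegularOnQuot (e ⁻¹' U) (f ∘ e)

/-! ### Branched double coverings and ramification -/

/-- `f` is a double covering branched along `D`: a proper surjection which is a two-sheeted covering
away from `D`, and at every point of `D` the two sheets come together. -/
structure IsDoubleCoveringBranchedAlong {X Y : Type} [TopologicalSpace X] [TopologicalSpace Y]
    (f : X → Y) (D : Set X) : Prop where
  proper : IsProperMap f
  surjective : Function.Surjective f
  covering : IsCoveringMapOn f (f '' D)ᶜ
  two_sheets : ∀ y ∉ f '' D, (f ⁻¹' {y}).ncard = 2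
  one_point : ∀ x ∈ D, f ⁻¹' {f x} = {x}
  branched : ∀ x ∈ D, ∀ U ∈ 𝓝 x, ¬ Set.InjOn f U

/-- The holomorphic differential of `cmMap n` at the point `x = ([u], [v])` is injective. The tangent
space of a projective space `P(V)` at `[u]` is `V / ℂ u`, and the differential of `cmMap n` is
induced on these quotients by the differential of `(u, v) ↦ pairing n u v`. -/
def DifferentialInjectiveAt (n : ℕ) (x : ProjSource n × ProjSource n) : Prop :=
  ∀ a b : Fin (n - 1) → ℂ,
    fderiv ℂ (fun p : (Fin (n - 1) → ℂ) × (Fin (n - 1) → ℂ) => pairing n p.1 p.2)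
        (x.1.rep, x.2.rep) (a, b) ∈ Submodule.span ℂ {pairing n x.1.rep x.2.rep} →
      a ∈ Submodule.span ℂ {x.1.rep} ∧ b ∈ Submodule.span ℂ {x.2.rep}

end CayleyMenger

end

open CayleyMenger

/-! The coordinates of `pairing n u v` carry the same information as the symmetric matrix S = u vᵀ +
v uᵀ, because u_i v_j + u_j v_i = u_i v_i + u_j v_j - (u_i - u_j)(v_i - v_j). The map therefore
multiplies two linear forms into a quadratic form, and everything rests on recovering the factors.
Choose w with q = wᵀSw = 2(w ⬝ u)(w ⬝ v) ≠ 0 and put r = Sw = (w ⬝ v)u + (w ⬝ u)v. Then r rᵀ - qS =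
d dᵀ with d = (w ⬝ v)u - (w ⬝ u)v, so r + d and r - d are multiples of u and v. Since d is known
only up to sign, the pair is known only up to order.

This yields equations for the image (`exists_eq_pairing`: r rᵀ - qS has rank at most one) and the
fibres (`cmMap_eq_iff`). A choice of w orthogonal to u gives the differential. Real configurations
are the pairs (x + iy, x - iy), which are Zariski dense among all pairs, so the image is the whole
variety. Compactness, the Hausdorff property and the shape of the fibres give the branched covering.

The algebraic isomorphism rests on `IsBihomogeneous.exists_symmetrization_eq`: symmetrized
polynomials of bidegree (N, N) are polynomials in the entries of S. Symmetrizing denominators and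
numerators then moves open sets and regular functions down to the variety. -/

noncomputable section

namespace CayleyMenger

open MvPolynomial

/-! ### Polynomials and scaling -/

/-- A weighted homogeneous polynomial is multiplied by the character `φ` of its weight when every
variable is multiplied by the character of its own weight. -/
theorem eval_weight_mul {σ M : Type*} [AddCommMonoid M] {w : σ → M} {m : M}
    (φ : Multiplicative M →* ℂ) {F : MvPolynomial σ ℂ} (hF : F.IsWeightedHomogeneous w m)
    (z : σ → ℂ) :
    eval (fun i => φ (Multiplicative.ofAdd (w i)) * z i) F =
      φ (Multiplicative.ofAdd m) * eval z F := by
  induction hF using IsWeightedHomogeneous.induction_on with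
  | zero => simp
  | add p q hp hq ihp ihq => simp only [map_add, ihp, ihq, mul_add]
  | monomial d r hr =>
    subst hr
    simp only [eval_monomial, Finsupp.weight_apply, Finsupp.prod, Finsupp.sum, mul_pow,
      Finset.prod_mul_distrib, ofAdd_sum, map_prod, ofAdd_nsmul, map_pow]
    ring

theorem eval_smul_of_isHomogeneous {σ : Type*} {F : MvPolynomial σ ℂ} {d : ℕ}
    (hF : F.IsHomogeneous d) (a : ℂ) (z : σ → ℂ) : eval (a • z) F = a ^ d * eval z F := by
  have := eval_weight_mul (powersHom ℂ a) hF z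
  simpa [powersHom_apply, Pi.smul_def] using this

theorem eval_bind₁_pi {σ τ : Type*} (f : σ → MvPolynomial τ ℂ) (z : τ → ℂ)
    (F : MvPolynomial σ ℂ) : eval z (bind₁ f F) = eval (fun i => eval z (f i)) F := by
  simp [← aeval_eq_eval, aeval_bind₁]

theorem eval_rep_mk {ι : Type} {F : MvPolynomial ι ℂ} {d : ℕ} (hF : F.IsHomogeneous d)
    {z : ι → ℂ} (hz : z ≠ 0) :
    eval (Projectivization.mk ℂ z hz).rep F = 0 ↔ eval z F = 0 := by
  obtain ⟨a, ha⟩ := Projectivization.exists_smul_eq_mk_rep ℂ z hz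
  rw [← ha, Units.smul_def, eval_smul_of_isHomogeneous hF]
  simp

theorem exists_rep_mk {ι : Type} {z : ι → ℂ} (hz : z ≠ 0) :
    ∃ a : ℂ, a ≠ 0 ∧ (Projectivization.mk ℂ z hz).rep = a • z := by
  obtain ⟨a, ha⟩ := Projectivization.exists_smul_eq_mk_rep ℂ z hz
  exact ⟨a, a.ne_zero, ha.symm⟩

/-! ### The symmetric matrix `u vᵀ + v uᵀ` -/

section Gram

variable {n : ℕ}

/-- The polynomial giving the entry `u_i v_j + u_j v_i` in terms of the coordinates of
`pairing n u v`. -/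
def gramPoly (n : ℕ) (i j : Fin (n - 1)) : MvPolynomial (PairIdx n) ℂ :=
  X (Sum.inl i) + X (Sum.inl j) -
    if h : i < j then X (Sum.inr ⟨(i, j), h⟩) else
      if h : j < i then X (Sum.inr ⟨(j, i), h⟩) else 0

/-- The value of `gramPoly`. -/
def gram (z : PairIdx n → ℂ) (i j : Fin (n - 1)) : ℂ := eval z (gramPoly n i j)

theorem isHomogeneous_gramPoly (i j : Fin (n - 1)) : (gramPoly n i j).IsHomogeneous 1 := by
  unfold gramPoly
  refine ((isHomogeneous_X _ _).add (isHomogeneous_X _ _)).sub ?_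
  split_ifs
  · exact isHomogeneous_X _ _
  · exact isHomogeneous_X _ _
  · exact isHomogeneous_zero _ _ _

theorem gram_pairing (u v : Fin (n - 1) → ℂ) (i j : Fin (n - 1)) :
    gram (pairing n u v) i j = u i * v j + u j * v i := by
  unfold gram gramPoly
  rcases lt_trichotomy i j with h | h | h
  · simp [h, pairing]; ring
  · subst h; simp [pairing]
  · simp [h, h.not_gt, pairing]; ring

theorem gram_comm (z : PairIdx n → ℂ) (i j : Fin (n - 1)) : gram z i j = gram z j i := by
  unfold gram gramPoly
  rcases lt_trichotomy i j with h | h | h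
  · simp [h, h.not_gt]; ring
  · subst h; rfl
  · simp [h, h.not_gt]; ring

theorem gram_smul (c : ℂ) (z : PairIdx n → ℂ) (i j : Fin (n - 1)) :
    gram (c • z) i j = c * gram z i j := by
  simpa [gram] using eval_smul_of_isHomogeneous (isHomogeneous_gramPoly i j) c z

theorem gram_injective : Function.Injective (gram (n := n)) := by
  intro z z' h
  have hl : ∀ i, z (Sum.inl i) = z' (Sum.inl i) := fun i => by
    have := congrFun₂ h i i
    simp only [gram, gramPoly, lt_irrefl, dite_false, sub_zero, map_add, eval_X] at this
    linear_combination this / 2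
  funext k
  rcases k with i | ⟨⟨i, j⟩, hij⟩
  · exact hl i
  · have := congrFun₂ h i j
    have hij' : i < j := hij
    simp only [gram, gramPoly, hij', dite_true, map_add, map_sub, eval_X, hl] at this
    linear_combination -this

/-- A symmetric matrix with vanishing quadratic form is zero. -/
theorem exists_quadratic_ne_zero {ι : Type*} [Fintype ι] [DecidableEq ι] {S : ι → ι → ℂ}
    (hS : ∀ i j, S i j = S j i) (h : S ≠ 0) : ∃ w : ι → ℂ, ∑ j, w j * ∑ i, w i * S i j ≠ 0 := by
  by_contra! hw
  have hd : ∀ i, S i i = 0 := fun i => by simpa [Pi.single_apply] using hw (Pi.single i 1)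
  apply h
  funext i j
  -- Polarisation: once the diagonal vanishes, the form at e_i + e_j is 2 S i j.
  have := hw (Pi.single i 1 + Pi.single j 1)
  simp only [Pi.add_apply, add_mul, Finset.sum_add_distrib, Pi.single_apply, ite_mul, one_mul,
    zero_mul, mul_add, Finset.sum_ite_eq', Finset.mem_univ, if_true, hd, hS j i] at this
  simp only [Pi.zero_apply]
  linear_combination this / 2

/-- A matrix all of whose principal-row minors vanish is of the form `d dᵀ`. -/
theorem exists_eq_mul_self {ι : Type*} {D : ι → ι → ℂ}
    (h : ∀ j k l, D j j * D k l = D j k * D j l) : ∃ d : ι → ℂ, ∀ k l, D k l = d k * d l := by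
  by_cases hD : ∃ j, D j j ≠ 0
  · obtain ⟨j, hj⟩ := hD
    obtain ⟨s, hs⟩ := IsAlgClosed.exists_pow_nat_eq (D j j) (n := 2) (by norm_num)
    have hs0 : s ≠ 0 := by rintro rfl; simp at hs; exact hj hs.symm
    refine ⟨fun k => D j k / s, fun k l => ?_⟩
    field_simp
    rw [hs, mul_comm, h]
  · push Not at hD
    refine ⟨0, fun k l => ?_⟩
    -- With zero diagonal, the minor relation reads 0 = (D k l)².
    have := h k l l
    rw [hD, zero_mul, eq_comm, mul_self_eq_zero] at this
    simp [this]

/-- The sign is fixed at one index where `e` is nonzero, and the products with that entry propagate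
it to all others. This sign is the only ambiguity when u and v are recovered, and it corresponds to
their order. -/
theorem eq_or_eq_neg_of_mul_eq_mul {ι : Type*} {d e : ι → ℂ}
    (h : ∀ k l, d k * d l = e k * e l) : d = e ∨ d = -e := by
  by_cases he : e = 0
  · left
    funext k
    have := h k k
    simpa [he] using this
  obtain ⟨k, hk⟩ := Function.ne_iff.mp he
  simp only [Pi.zero_apply] at hk
  rcases mul_self_eq_mul_self_iff.mp (h k k) with hkk | hkk
  · left
    funext l
    have := h k l
    rw [hkk] at this
    exact mul_left_cancel₀ hk this
  · right
    funext l
    have := h k l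
    rw [hkk] at this
    refine mul_left_cancel₀ hk ?_
    simp only [Pi.neg_apply]
    linear_combination -this

/-- The polynomial `∑ w_i (u_i v_j + u_j v_i)`. -/
def rowPoly (n : ℕ) (w : Fin (n - 1) → ℂ) (j : Fin (n - 1)) : MvPolynomial (PairIdx n) ℂ :=
  ∑ i, C (w i) * gramPoly n i j

/-- The polynomial `∑ w_i w_j (u_i v_j + u_j v_i)`. -/
def quadPoly (n : ℕ) (w : Fin (n - 1) → ℂ) : MvPolynomial (PairIdx n) ℂ :=
  ∑ j, C (w j) * rowPoly n w j

/-- The polynomial `d_j d_k`, where `d = (w ⬝ v) u - (w ⬝ u) v`. -/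
def discPoly (n : ℕ) (w : Fin (n - 1) → ℂ) (j k : Fin (n - 1)) : MvPolynomial (PairIdx n) ℂ :=
  rowPoly n w j * rowPoly n w k - quadPoly n w * gramPoly n j k

theorem isHomogeneous_rowPoly (w : Fin (n - 1) → ℂ) (j : Fin (n - 1)) :
    (rowPoly n w j).IsHomogeneous 1 :=
  IsHomogeneous.sum _ _ _ fun i _ => (isHomogeneous_gramPoly i j).C_mul _

theorem isHomogeneous_quadPoly (w : Fin (n - 1) → ℂ) : (quadPoly n w).IsHomogeneous 1 :=
  IsHomogeneous.sum _ _ _ fun j _ => (isHomogeneous_rowPoly w j).C_mul _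

theorem isHomogeneous_discPoly (w : Fin (n - 1) → ℂ) (j k : Fin (n - 1)) :
    (discPoly n w j k).IsHomogeneous 2 :=
  ((isHomogeneous_rowPoly w j).mul (isHomogeneous_rowPoly w k)).sub
    ((isHomogeneous_quadPoly w).mul (isHomogeneous_gramPoly j k))

theorem eval_rowPoly_pairing (w u v : Fin (n - 1) → ℂ) (j : Fin (n - 1)) :
    eval (pairing n u v) (rowPoly n w j) = (w ⬝ᵥ v) * u j + (w ⬝ᵥ u) * v j := by
  simp only [rowPoly, map_sum, map_mul, eval_C, dotProduct, Finset.sum_mul]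
  rw [← Finset.sum_add_distrib]
  refine Finset.sum_congr rfl fun i _ => ?_
  have := gram_pairing u v i j
  rw [gram] at this
  rw [this]
  ring

theorem eval_quadPoly_pairing (w u v : Fin (n - 1) → ℂ) :
    eval (pairing n u v) (quadPoly n w) = 2 * (w ⬝ᵥ u) * (w ⬝ᵥ v) := by
  simp only [quadPoly, map_sum, map_mul, eval_C, eval_rowPoly_pairing]
  have h1 : w ⬝ᵥ u = ∑ j, w j * u j := rfl
  have h2 : w ⬝ᵥ v = ∑ j, w j * v j := rfl
  calc ∑ j, w j * ((w ⬝ᵥ v) * u j + (w ⬝ᵥ u) * v j)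
      = (w ⬝ᵥ v) * ∑ j, w j * u j + (w ⬝ᵥ u) * ∑ j, w j * v j := by
        rw [Finset.mul_sum, Finset.mul_sum, ← Finset.sum_add_distrib]
        exact Finset.sum_congr rfl fun j _ => by ring
    _ = _ := by rw [← h1, ← h2]; ring

theorem eval_discPoly_pairing (w u v : Fin (n - 1) → ℂ) (j k : Fin (n - 1)) :
    eval (pairing n u v) (discPoly n w j k) =
      ((w ⬝ᵥ v) * u j - (w ⬝ᵥ u) * v j) * ((w ⬝ᵥ v) * u k - (w ⬝ᵥ u) * v k) := by
  have := gram_pairing u v j k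
  rw [gram] at this
  simp only [discPoly, map_sub, map_mul, eval_rowPoly_pairing, eval_quadPoly_pairing, this]
  ring

/-- For `z = pairing n u v` such a `w` has both w ⬝ u and w ⬝ v nonzero, which allows division by
them. -/
theorem exists_quadPoly_ne_zero {z : PairIdx n → ℂ} (hz : z ≠ 0) :
    ∃ w, eval z (quadPoly n w) ≠ 0 := by
  obtain ⟨w, hw⟩ := exists_quadratic_ne_zero (gram_comm z) (S := gram z) fun h =>
    hz (gram_injective (h.trans (by funext i j; simpa using (gram_smul 0 z i j).symm)))
  refine ⟨w, ?_⟩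
  simpa [quadPoly, rowPoly, gram] using hw

/-- The equations of the set of all vectors `pairing n u v`. -/
theorem exists_eq_pairing {z : PairIdx n → ℂ} (hz : z ≠ 0)
    (h : ∀ w j k l, eval z (discPoly n w j j * discPoly n w k l -
      discPoly n w j k * discPoly n w j l) = 0) :
    ∃ u v, u ≠ 0 ∧ v ≠ 0 ∧ z = pairing n u v := by
  obtain ⟨w, hw⟩ := exists_quadPoly_ne_zero hz
  obtain ⟨d, hd⟩ := exists_eq_mul_self (D := fun j k => eval z (discPoly n w j k))
    (fun j k l => by simpa [sub_eq_zero] using h w j k l)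
  set q := eval z (quadPoly n w) with hq
  set a : Fin (n - 1) → ℂ := fun j => eval z (rowPoly n w j) with ha
  -- On an actual pairing, a + d = 2(w ⬝ v)u and a - d = 2(w ⬝ u)v, whose coefficients multiply to
  -- 2q. In general the matrix of (a + d, a - d) is 2(a aᵀ - d dᵀ) = 2q S.
  have key : z = pairing n ((2 * q)⁻¹ • (a + d)) (a - d) := by
    apply gram_injective
    funext j k
    rw [gram_pairing]
    have := hd j k
    simp only [discPoly, map_sub, map_mul, ← hq] at this
    change a j * a k - q * gram z j k = _ at this
    simp only [Pi.smul_apply, Pi.add_apply, Pi.sub_apply, smul_eq_mul]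
    field_simp
    linear_combination (-2) * this
  refine ⟨_, _, ?_, ?_, key⟩
  · intro h0
    rw [h0] at key
    exact hz (key.trans (by funext k; rcases k with k | k <;> simp [pairing]))
  · intro h0
    rw [h0] at key
    exact hz (key.trans (by funext k; rcases k with k | k <;> simp [pairing]))

/-! ### The fibres of the map -/

theorem pairing_comm (u v : Fin (n - 1) → ℂ) : pairing n u v = pairing n v u := by
  funext k
  rcases k with k | k <;> simp [pairing, mul_comm]

/-- For a common `w`, the vectors r agree up to the factor c and the vectors d up to ±c. Half the
sum and half the difference isolate multiples of u and v; the sign + keeps the order of u', v' and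
the sign - exchanges them. -/
theorem eq_smul_of_pairing_eq_smul {u v u' v' : Fin (n - 1) → ℂ} {c : ℂ}
    (hu : u ≠ 0) (hv : v ≠ 0) (h : pairing n u v = c • pairing n u' v') :
    (∃ a b : ℂ, u = a • u' ∧ v = b • v') ∨ ∃ a b : ℂ, u = a • v' ∧ v = b • u' := by
  obtain ⟨w, hw⟩ := exists_quadPoly_ne_zero (pairing_ne_zero hu hv)
  have hrow : ∀ j, (w ⬝ᵥ v) * u j + (w ⬝ᵥ u) * v j =
      c * ((w ⬝ᵥ v') * u' j + (w ⬝ᵥ u') * v' j) := fun j => by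
    rw [← eval_rowPoly_pairing, h, eval_smul_of_isHomogeneous (isHomogeneous_rowPoly w j),
      eval_rowPoly_pairing, pow_one]
  have hdisc : ∀ j k, ((w ⬝ᵥ v) * u j - (w ⬝ᵥ u) * v j) * ((w ⬝ᵥ v) * u k - (w ⬝ᵥ u) * v k) =
      (c * ((w ⬝ᵥ v') * u' j - (w ⬝ᵥ u') * v' j)) *
        (c * ((w ⬝ᵥ v') * u' k - (w ⬝ᵥ u') * v' k)) := fun j k => by
    rw [← eval_discPoly_pairing, h, eval_smul_of_isHomogeneous (isHomogeneous_discPoly w j k),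
      eval_discPoly_pairing]
    ring
  rw [eval_quadPoly_pairing] at hw
  have hα : w ⬝ᵥ u ≠ 0 := fun h0 => hw (by simp [h0])
  have hβ : w ⬝ᵥ v ≠ 0 := fun h0 => hw (by simp [h0])
  rcases eq_or_eq_neg_of_mul_eq_mul hdisc with hd | hd
  · left
    refine ⟨c * (w ⬝ᵥ v') / (w ⬝ᵥ v), c * (w ⬝ᵥ u') / (w ⬝ᵥ u), ?_, ?_⟩ <;>
    · funext j
      have h1 := hrow j
      have h2 := congrFun hd j
      simp only [Pi.smul_apply, smul_eq_mul]
      field_simp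
      first | linear_combination (h1 + h2) / 2 | linear_combination (h1 - h2) / 2
  · right
    refine ⟨c * (w ⬝ᵥ u') / (w ⬝ᵥ v), c * (w ⬝ᵥ v') / (w ⬝ᵥ u), ?_, ?_⟩ <;>
    · funext j
      have h1 := hrow j
      have h2 := congrFun hd j
      simp only [Pi.neg_apply] at h2
      simp only [Pi.smul_apply, smul_eq_mul]
      field_simp
      first | linear_combination (h1 + h2) / 2 | linear_combination (h1 - h2) / 2

theorem cmMap_swap (x : ProjSource n × ProjSource n) : cmMap n x.swap = cmMap n x := by
  obtain ⟨p, q⟩ := x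
  induction p using Projectivization.ind with
  | h u hu =>
    induction q using Projectivization.ind with
    | h v hv =>
      simp only [Prod.swap_prod_mk, cmMap_mk, pairing_comm v u]

theorem cmMap_eq_iff {x y : ProjSource n × ProjSource n} :
    cmMap n x = cmMap n y ↔ x = y ∨ x = y.swap := by
  refine ⟨fun h => ?_, ?_⟩
  · obtain ⟨p, q⟩ := x
    obtain ⟨p', q'⟩ := y
    induction p using Projectivization.ind with
    | h u hu =>
    induction q using Projectivization.ind with
    | h v hv =>
    induction p' using Projectivization.ind with
    | h u' hu' =>
    induction q' using Projectivization.ind with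
    | h v' hv' =>
    rw [cmMap_mk, cmMap_mk, Projectivization.mk_eq_mk_iff'] at h
    obtain ⟨c, hc⟩ := h
    simp only [Prod.swap_prod_mk, Prod.mk.injEq, Projectivization.mk_eq_mk_iff']
    rcases eq_smul_of_pairing_eq_smul hu hv hc.symm with ⟨a, b, ha, hb⟩ | ⟨a, b, ha, hb⟩
    · exact Or.inl ⟨⟨a, ha.symm⟩, ⟨b, hb.symm⟩⟩
    · exact Or.inr ⟨⟨a, ha.symm⟩, ⟨b, hb.symm⟩⟩
  · rintro (rfl | rfl)
    · rfl
    · exact cmMap_swap y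

end Gram

/-! ### The image of the map is the Cayley–Menger variety -/

/-- The coordinates of `pairing n u v` as polynomials in `u` and `v`. -/
def pairingPoly (n : ℕ) : PairIdx n → MvPolynomial (Fin (n - 1) ⊕ Fin (n - 1)) ℂ :=
  Sum.elim (fun i => X (Sum.inl i) * X (Sum.inr i))
    (fun p => (X (Sum.inl p.1.1) - X (Sum.inl p.1.2)) * (X (Sum.inr p.1.1) - X (Sum.inr p.1.2)))

theorem eval_pairingPoly {n : ℕ} (u v : Fin (n - 1) → ℂ) :
    (fun k => eval (Sum.elim u v) (pairingPoly n k)) = pairing n u v := by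
  funext k
  rcases k with k | k <;> simp [pairingPoly, pairing]

theorem eval_bind₁_pairingPoly {n : ℕ} (F : MvPolynomial (PairIdx n) ℂ) (u v : Fin (n - 1) → ℂ) :
    eval (Sum.elim u v) (bind₁ (pairingPoly n) F) = eval (pairing n u v) F := by
  rw [eval_bind₁_pi, eval_pairingPoly]

/-- The squared distances of a configuration are the pairing of its complex coordinates with
their conjugates. -/
theorem sqDist_eq_pairing {n : ℕ} (z : Fin (n - 1) → Plane) :
    sqDist n z = pairing n (fun i => (z i 0 : ℂ) + z i 1 * Complex.I)
      (fun i => (z i 0 : ℂ) - z i 1 * Complex.I) := by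
  funext k
  rcases k with i | p
  · simp only [sqDist, Sum.elim_inl, pairing, EuclideanSpace.dist_eq, Fin.sum_univ_two,
      Real.dist_eq, sq_abs]
    rw [Real.sq_sqrt (by positivity)]
    simp only [PiLp.zero_apply, sub_zero]
    push_cast
    linear_combination (z i 1 : ℂ) ^ 2 * Complex.I_sq
  · simp only [sqDist, Sum.elim_inr, pairing, EuclideanSpace.dist_eq, Fin.sum_univ_two,
      Real.dist_eq, sq_abs]
    rw [Real.sq_sqrt (by positivity)]
    push_cast
    linear_combination ((z p.1.1 1 : ℂ) - z p.1.2 1) ^ 2 * Complex.I_sq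

theorem range_distMap_subset (n : ℕ) : Set.range (distMap n) ⊆ Set.range (cmMap n) := by
  rintro _ ⟨x, rfl⟩
  induction x using Quotient.ind with
  | _ x =>
  induction x using Projectivization.ind with
  | h z hz =>
    have hne : ∀ s : ℂ, s = Complex.I ∨ s = -Complex.I →
        (fun i => (z i 0 : ℂ) + z i 1 * s) ≠ 0 := by
      intro s hs h
      apply hz
      funext i
      have hi := congrFun h i
      have h0 := congrArg Complex.re hi
      have h1 := congrArg Complex.im hi
      ext k
      fin_cases k
      · rcases hs with rfl | rfl <;> simpa using h0
      · rcases hs with rfl | rfl <;> simpa using h1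
    have h2 := hne _ (Or.inr rfl)
    simp only [mul_neg, ← sub_eq_add_neg] at h2
    refine ⟨(Projectivization.mk ℂ _ (hne _ (Or.inl rfl)), Projectivization.mk ℂ _ h2), ?_⟩
    rw [cmMap_mk]
    change _ = Projectivization.mk ℂ (sqDist n z) (sqDist_ne_zero hz)
    congr 1
    exact (sqDist_eq_pairing z).symm

/-- A polynomial vanishing at all points `(x + i y, x - i y)`, with `x`, `y` vectors of nonzero
real numbers, vanishes everywhere. -/
theorem eval_eq_zero_of_conj {ι : Type} {G : MvPolynomial (ι ⊕ ι) ℂ}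
    (h : ∀ x y : ι → ℝ, (∀ i, x i ≠ 0) → (∀ i, y i ≠ 0) →
      eval (Sum.elim (fun i => (x i : ℂ) + y i * Complex.I)
        (fun i => (x i : ℂ) - y i * Complex.I)) G = 0) (u v : ι → ℂ) :
    eval (Sum.elim u v) G = 0 := by
  let f : ι ⊕ ι → MvPolynomial (ι ⊕ ι) ℂ :=
    Sum.elim (fun i => X (Sum.inl i) + X (Sum.inr i) * C Complex.I)
      (fun i => X (Sum.inl i) - X (Sum.inr i) * C Complex.I)
  have hf : ∀ a b : ι → ℂ, eval (Sum.elim a b) (bind₁ f G) =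
      eval (Sum.elim (fun i => a i + b i * Complex.I) (fun i => a i - b i * Complex.I)) G := by
    intro a b
    rw [eval_bind₁_pi]
    congr 2
    funext k
    rcases k with k | k <;> simp [f]
  have h0 : bind₁ f G = 0 := by
    refine funext_set (fun _ => Complex.ofReal '' {0}ᶜ) (fun _ => ?_) fun x hx => ?_
    · exact (Set.infinite_image_iff Complex.ofReal_injective.injOn).mpr
        (Set.finite_singleton 0).infinite_compl
    · choose r hr hrx using fun i => hx i (Set.mem_univ i)
      have hx' : x = Sum.elim (fun i => (r (Sum.inl i) : ℂ)) (fun i => (r (Sum.inr i) : ℂ)) := by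
        funext k
        rcases k with k | k <;> simp [hrx]
      rw [hx', hf, map_zero]
      exact h _ _ (fun i => hr _) (fun i => hr _)
  have := hf (fun i => (u i + v i) / 2) (fun i => (u i - v i) / (2 * Complex.I))
  rw [h0, map_zero] at this
  rw [this]
  congr 2
  funext k
  have hI := Complex.I_ne_zero
  rcases k with k | k
  · simp only [Sum.elim_inl]; field_simp; ring
  · simp only [Sum.elim_inr]; field_simp; ring

/-- The image lies in the closure by density of the conjugate pairs. Conversely, the quartic minors
of r rᵀ - qS vanish on real configurations, hence on their closure, and they force a point to be a
pairing. -/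
theorem range_cmMap {n : ℕ} (hn : 3 ≤ n) : Set.range (cmMap n) = cmVariety n := by
  apply Set.Subset.antisymm
  · rintro _ ⟨⟨p, q⟩, rfl⟩
    induction p using Projectivization.ind with
    | h u hu =>
    induction q using Projectivization.ind with
    | h v hv =>
    intro F d hF hvan
    rw [cmMap_mk, eval_rep_mk hF, ← eval_bind₁_pairingPoly]
    refine eval_eq_zero_of_conj (fun x y hx hy => ?_) u v
    let z : Fin (n - 1) → Plane := fun i => !₂[x i, y i]
    -- Nonzero coordinates guarantee that the configuration is not the excluded one.
    have hz : z ≠ 0 := by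
      intro h
      have := congrArg (fun p : Plane => p 0) (congrFun h ⟨0, by omega⟩)
      exact hx ⟨0, by omega⟩ (by simpa [z] using this)
    have := hvan _ ⟨Quotient.mk _ (Projectivization.mk ℝ z hz), rfl⟩
    change eval (Projectivization.mk ℂ (sqDist n z) (sqDist_ne_zero hz)).rep F = 0 at this
    rw [eval_rep_mk hF, sqDist_eq_pairing] at this
    rw [eval_bind₁_pairingPoly]
    simpa [z] using this
  · intro x hx
    obtain ⟨u, v, hu, hv, h⟩ := exists_eq_pairing x.rep_nonzero (fun w j k l => by
      have hF : (discPoly n w j j * discPoly n w k l -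
          discPoly n w j k * discPoly n w j l).IsHomogeneous (2 + 2) :=
        ((isHomogeneous_discPoly _ _ _).mul (isHomogeneous_discPoly _ _ _)).sub
          ((isHomogeneous_discPoly _ _ _).mul (isHomogeneous_discPoly _ _ _))
      refine hx _ _ hF fun y hy => ?_
      obtain ⟨⟨p, q⟩, rfl⟩ := range_distMap_subset n hy
      induction p using Projectivization.ind with
      | h u hu =>
      induction q using Projectivization.ind with
      | h v hv =>
      rw [cmMap_mk, eval_rep_mk hF]
      simp only [map_sub, map_mul, eval_discPoly_pairing]
      ring)
    refine ⟨(Projectivization.mk ℂ u hu, Projectivization.mk ℂ v hv), ?_⟩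
    rw [cmMap_mk, ← Projectivization.mk_rep x]
    congr 1
    exact h.symm

/-! ### The differential -/

/-- `pairing` as a bilinear map. -/
def pairingBilin (n : ℕ) :
    (Fin (n - 1) → ℂ) →ₗ[ℂ] (Fin (n - 1) → ℂ) →ₗ[ℂ] (PairIdx n → ℂ) :=
  LinearMap.mk₂ ℂ (pairing n)
    (fun _ _ _ => by funext k; rcases k with k | k <;> simp [pairing] <;> ring)
    (fun _ _ _ => by funext k; rcases k with k | k <;> simp [pairing] <;> ring)
    (fun _ _ _ => by funext k; rcases k with k | k <;> simp [pairing] <;> ring)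
    (fun _ _ _ => by funext k; rcases k with k | k <;> simp [pairing] <;> ring)

theorem fderiv_pairing {n : ℕ} (u v a b : Fin (n - 1) → ℂ) :
    fderiv ℂ (fun p : (Fin (n - 1) → ℂ) × (Fin (n - 1) → ℂ) => pairing n p.1 p.2) (u, v) (a, b) =
      pairing n u b + pairing n a v := by
  let B : (Fin (n - 1) → ℂ) →L[ℂ] (Fin (n - 1) → ℂ) →L[ℂ] (PairIdx n → ℂ) :=
    LinearMap.toContinuousLinearMap
      (LinearMap.toContinuousLinearMap.toLinearMap ∘ₗ pairingBilin n)
  have hB : ∀ p q, B p q = pairing n p q := fun _ _ => rfl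
  have := (B.isBoundedBilinearMap.hasFDerivAt (u, v)).fderiv
  simp only [hB] at this
  rw [this]
  simp

/-- If the symmetric product of `a` and `v` equals, up to sign, the one of `u` and `b`, with `u`
and `v` independent, then `a` is proportional to `u`. -/
theorem mem_span_of_pairing_add_eq_zero {n : ℕ} {u v a b : Fin (n - 1) → ℂ}
    (huv : v ∉ Submodule.span ℂ {u}) (h : pairing n u b + pairing n a v = 0) :
    a ∈ Submodule.span ℂ {u} := by
  -- Take w to be the coefficient vector of a functional killing u but not v. The quadratic form at
  -- w gives f a * f v = 0, hence f a = 0, and the row at w then reads f v • a = -(f b) • u.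
  obtain ⟨f, hf, hfu⟩ := Submodule.exists_le_ker_of_notMem huv
  have hu0 : f u = 0 := hfu (Submodule.mem_span_singleton_self u)
  have hsum : ∀ x : Fin (n - 1) → ℂ, f x = ∑ i, f (Pi.single i 1) * x i := by
    intro x
    conv_lhs => rw [← Finset.univ_sum_single x]
    rw [map_sum]
    refine Finset.sum_congr rfl fun i _ => ?_
    have : (Pi.single i (x i) : Fin (n - 1) → ℂ) = x i • Pi.single i 1 := by
      rw [← Pi.single_smul, smul_eq_mul, mul_one]
    rw [this, map_smul, smul_eq_mul, mul_comm]
  set w : Fin (n - 1) → ℂ := fun i => f (Pi.single i 1) with hw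
  have hdot : ∀ x, w ⬝ᵥ x = f x := fun x => (hsum x).symm
  have hneg : pairing n u b = (-1 : ℂ) • pairing n a v := by
    rw [neg_one_smul]; exact eq_neg_of_add_eq_zero_left h
  have hq : f a * f v = 0 := by
    have := eval_quadPoly_pairing w u b
    rw [hneg, eval_smul_of_isHomogeneous (isHomogeneous_quadPoly w), eval_quadPoly_pairing,
      hdot, hdot, hdot, hu0] at this
    linear_combination -this / 2
  have ha : f a = 0 := (mul_eq_zero.mp hq).resolve_right hf
  have hrow : ∀ j, f v * a j = -(f b) * u j := fun j => by
    have := eval_rowPoly_pairing w u b j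
    rw [hneg, eval_smul_of_isHomogeneous (isHomogeneous_rowPoly w j), eval_rowPoly_pairing,
      hdot, hdot, hdot, hdot, hu0, ha] at this
    linear_combination -this
  refine Submodule.mem_span_singleton.mpr ⟨-(f b) / f v, ?_⟩
  funext j
  simp only [Pi.smul_apply, smul_eq_mul]
  field_simp
  linear_combination -hrow j

theorem exists_notMem_span {n : ℕ} (hn : 3 ≤ n) (u : Fin (n - 1) → ℂ) :
    ∃ a : Fin (n - 1) → ℂ, a ∉ Submodule.span ℂ {u} := by
  by_contra! h
  have h1 : Submodule.span ℂ {u} = ⊤ := Submodule.eq_top_iff'.mpr h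
  have h2 := finrank_span_le_card (R := ℂ) ({u} : Set (Fin (n - 1) → ℂ))
  rw [h1, finrank_top, Module.finrank_fin_fun, Set.toFinset_singleton, Finset.card_singleton] at h2
  omega

/-- On the diagonal, symmetry of the pairing kills every direction (a, -a), and n ≥ 3 leaves room
for a ∉ ℂ u. Off the diagonal, a value c • `pairing n u v` is absorbed by replacing a with a - c u,
or b with b - c v, which reduces to the linear equation with right-hand side zero. -/
theorem differentialInjectiveAt_iff {n : ℕ} (hn : 3 ≤ n) (x : ProjSource n × ProjSource n) :
    DifferentialInjectiveAt n x ↔ x ∉ Set.diagonal (ProjSource n) := by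
  obtain ⟨p, q⟩ := x
  constructor
  · intro h hpq
    have hpq' : p = q := hpq
    subst hpq'
    obtain ⟨a, ha⟩ := exists_notMem_span hn p.rep
    refine ha (h a (-a) ?_).1
    simp only [fderiv_pairing]
    have : pairing n p.rep (-a) + pairing n a p.rep = 0 := by
      rw [pairing_comm a]
      funext k
      rcases k with k | k <;> simp [pairing]
      ring
    rw [this]
    exact zero_mem _
  · intro hpq a b hab
    have hpq' : p ≠ q := hpq
    simp only [fderiv_pairing] at hab
    obtain ⟨c, hc⟩ := Submodule.mem_span_singleton.mp hab
    have hne : ∀ {p q : ProjSource n}, p ≠ q → q.rep ∉ Submodule.span ℂ {p.rep} := by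
      intro p q hpq hm
      obtain ⟨t, ht⟩ := Submodule.mem_span_singleton.mp hm
      apply hpq
      rw [← Projectivization.mk_rep p, ← Projectivization.mk_rep q, eq_comm,
        Projectivization.mk_eq_mk_iff']
      exact ⟨t, ht⟩
    constructor
    · have h1 : pairing n p.rep b + pairing n (a - c • p.rep) q.rep = 0 := by
        have : pairing n (a - c • p.rep) q.rep = pairing n a q.rep - c • pairing n p.rep q.rep := by
          funext k
          rcases k with k | k <;> simp [pairing] <;> ring
        rw [this, hc]
        abel
      have := mem_span_of_pairing_add_eq_zero (hne hpq') h1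
      exact (Submodule.sub_mem_iff_left _
        (Submodule.smul_mem _ c (Submodule.mem_span_singleton_self _))).mp this
    · have h1 : pairing n q.rep a + pairing n (b - c • q.rep) p.rep = 0 := by
        have : pairing n (b - c • q.rep) p.rep = pairing n p.rep b - c • pairing n p.rep q.rep := by
          funext k
          rcases k with k | k <;> simp [pairing] <;> ring
        rw [this, hc, pairing_comm q.rep]
        abel
      have := mem_span_of_pairing_add_eq_zero (hne hpq'.symm) h1
      exact (Submodule.sub_mem_iff_left _
        (Submodule.smul_mem _ c (Submodule.mem_span_singleton_self _))).mp this

/-! ### The classical topology of a complex projective space -/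

theorem isOpenQuotientMap_mk' (ι : Type) :
    IsOpenQuotientMap (Projectivization.mk' ℂ (V := ι → ℂ)) where
  surjective := Quotient.mk''_surjective
  continuous := continuous_coinduced_rng
  isOpenMap := by
    intro U hU
    rw [isOpen_coinduced]
    -- The saturation of U is the union of its preimages under the scalings by units, each of them
    -- open.
    have hs : Projectivization.mk' ℂ ⁻¹' (Projectivization.mk' ℂ '' U) =
        ⋃ a : ℂˣ, (fun v : {v : ι → ℂ // v ≠ 0} =>
          (⟨a • v.1, (smul_ne_zero_iff_ne a).mpr v.2⟩ : {v : ι → ℂ // v ≠ 0})) ⁻¹' U := by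
      ext v
      simp only [Set.mem_preimage, Set.mem_image, Set.mem_iUnion]
      constructor
      · rintro ⟨w, hw, h⟩
        rw [Projectivization.mk'_eq_mk, Projectivization.mk'_eq_mk,
          Projectivization.mk_eq_mk_iff] at h
        obtain ⟨a, ha⟩ := h
        refine ⟨a, ?_⟩
        have : (⟨a • v.1, (smul_ne_zero_iff_ne a).mpr v.2⟩ : {v : ι → ℂ // v ≠ 0}) = w :=
          Subtype.ext ha
        rwa [this]
      · rintro ⟨a, ha⟩
        refine ⟨_, ha, ?_⟩
        rw [Projectivization.mk'_eq_mk, Projectivization.mk'_eq_mk, Projectivization.mk_eq_mk_iff]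
        exact ⟨a, rfl⟩
    rw [hs]
    refine isOpen_iUnion fun a => hU.preimage ?_
    exact (continuous_subtype_val.const_smul a).subtype_mk _

theorem mk_eq_mk_iff_mul_comm {ι : Type} {v w : ι → ℂ} (hv : v ≠ 0) (hw : w ≠ 0) :
    Projectivization.mk ℂ v hv = Projectivization.mk ℂ w hw ↔ ∀ i j, v i * w j = v j * w i := by
  rw [Projectivization.mk_eq_mk_iff']
  constructor
  · rintro ⟨a, rfl⟩ i j
    simp only [Pi.smul_apply, smul_eq_mul]
    ring
  · intro h
    obtain ⟨j, hj⟩ := Function.ne_iff.mp hw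
    simp only [Pi.zero_apply] at hj
    refine ⟨v j / w j, ?_⟩
    funext i
    simp only [Pi.smul_apply, smul_eq_mul]
    field_simp
    rw [mul_comm (w j), h i j]

/-- For an open quotient map, the Hausdorff property amounts to closedness of the equivalence
relation, and proportionality is cut out by 2 × 2 minors. -/
instance t2Space_projectivization {ι : Type} : T2Space (ℙ ℂ (ι → ℂ)) := by
  rw [t2Space_iff_of_isOpenQuotientMap (isOpenQuotientMap_mk' ι)]
  simp only [Projectivization.mk'_eq_mk, mk_eq_mk_iff_mul_comm, Set.ofPred_forall]
  refine isClosed_iInter fun i => isClosed_iInter fun j => isClosed_eq ?_ ?_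
  · exact ((continuous_apply i).comp (continuous_subtype_val.comp continuous_fst)).mul
      ((continuous_apply j).comp (continuous_subtype_val.comp continuous_snd))
  · exact ((continuous_apply j).comp (continuous_subtype_val.comp continuous_fst)).mul
      ((continuous_apply i).comp (continuous_subtype_val.comp continuous_snd))

instance compactSpace_projectivization {ι : Type} [Finite ι] : CompactSpace (ℙ ℂ (ι → ℂ)) := by
  have := Fintype.ofFinite ι
  have hS : ∀ v : Metric.sphere (0 : ι → ℂ) 1, v.1 ≠ 0 := fun v =>
    ne_zero_of_mem_unit_sphere v
  let f : Metric.sphere (0 : ι → ℂ) 1 → ℙ ℂ (ι → ℂ) := fun v => Projectivization.mk' ℂ ⟨v.1, hS v⟩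
  have hf : Continuous f :=
    (isOpenQuotientMap_mk' ι).continuous.comp (continuous_subtype_val.subtype_mk _)
  have : Function.Surjective f := by
    intro p
    induction p using Projectivization.ind with
    | h v hv =>
      have hv' : ‖v‖ ≠ 0 := norm_ne_zero_iff.mpr hv
      refine ⟨⟨(‖v‖⁻¹ : ℂ) • v, by simp [norm_smul, hv']⟩, ?_⟩
      simp only [f, Projectivization.mk'_eq_mk, Projectivization.mk_eq_mk_iff']
      exact ⟨_, rfl⟩
  exact this.compactSpace hf

theorem continuous_pairing (n : ℕ) :
    Continuous fun p : (Fin (n - 1) → ℂ) × (Fin (n - 1) → ℂ) => pairing n p.1 p.2 := by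
  refine continuous_pi fun k => ?_
  rcases k with k | k <;> simp only [pairing, Sum.elim_inl, Sum.elim_inr] <;> fun_prop

theorem continuous_cmMap (n : ℕ) : Continuous (cmMap n) := by
  -- Openness matters here: a product of open quotient maps is again a quotient map, so continuity
  -- may be tested on vectors.
  have hq := (isOpenQuotientMap_mk' (Fin (n - 1))).prodMap (isOpenQuotientMap_mk' (Fin (n - 1)))
  rw [hq.isQuotientMap.continuous_iff]
  have h1 : Continuous fun x : {u : Fin (n - 1) → ℂ // u ≠ 0} × {v : Fin (n - 1) → ℂ // v ≠ 0} =>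
      (⟨pairing n x.1.1 x.2.1, pairing_ne_zero x.1.2 x.2.2⟩ : {z : PairIdx n → ℂ // z ≠ 0}) :=
    ((continuous_pairing n).comp (by fun_prop :
      Continuous fun x : {u : Fin (n - 1) → ℂ // u ≠ 0} × {v : Fin (n - 1) → ℂ // v ≠ 0} =>
        (x.1.1, x.2.1))).subtype_mk _
  exact (isOpenQuotientMap_mk' (PairIdx n)).continuous.comp h1

/-- Projective spaces of positive dimension have no isolated point. -/
theorem exists_ne_mem_of_mem_nhds {n : ℕ} (hn : 3 ≤ n) (p : ProjSource n) {U : Set (ProjSource n)}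
    (hU : U ∈ 𝓝 p) : ∃ q ∈ U, q ≠ p := by
  induction p using Projectivization.ind with
  | h u hu =>
    obtain ⟨a, ha⟩ := exists_notMem_span hn u
    have hne : ∀ t : ℂ, u + t • a ≠ 0 := by
      intro t h
      rcases eq_or_ne t 0 with rfl | ht
      · simp [hu] at h
      · apply ha
        refine Submodule.mem_span_singleton.mpr ⟨-t⁻¹, ?_⟩
        rw [eq_neg_of_add_eq_zero_left h, smul_neg, neg_smul, neg_neg, smul_smul,
          inv_mul_cancel₀ ht, one_smul]
    -- A projective line through [u] in a direction independent of u: it returns to [u] only at t =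
    -- 0.
    let c : ℂ → ProjSource n := fun t => Projectivization.mk' ℂ ⟨u + t • a, hne t⟩
    have hc : Continuous c :=
      (isOpenQuotientMap_mk' _).continuous.comp (Continuous.subtype_mk (by fun_prop) _)
    have hc0 : c 0 = Projectivization.mk ℂ u hu := by
      simp only [c, Projectivization.mk'_eq_mk, zero_smul, add_zero]
    have hev : ∀ᶠ t in 𝓝[≠] (0 : ℂ), c t ∈ U :=
      (hc.tendsto 0).mono_left nhdsWithin_le_nhds (hc0 ▸ hU)
    obtain ⟨t, ht, ht0⟩ := (hev.and eventually_mem_nhdsWithin).exists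
    refine ⟨c t, ht, fun h => ha ?_⟩
    simp only [c, Projectivization.mk'_eq_mk, Projectivization.mk_eq_mk_iff'] at h
    obtain ⟨s, hs⟩ := h
    have ht0' : t ≠ 0 := ht0
    refine Submodule.mem_span_singleton.mpr ⟨t⁻¹ * (s - 1), ?_⟩
    rw [mul_smul, sub_smul, hs, one_smul, add_sub_cancel_left, smul_smul, inv_mul_cancel₀ ht0',
      one_smul]

/-! ### Symmetric double coverings -/

/-- A continuous surjection from the square of a compact Hausdorff space without isolated points to
a Hausdorff space, whose fibres are the orbits of the exchange of the factors, is a double covering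
branched along the diagonal. -/
theorem isDoubleCoveringBranchedAlong_diagonal {X Y : Type} [TopologicalSpace X]
    [TopologicalSpace Y] [CompactSpace X] [T2Space X] [T2Space Y]
    (hX : ∀ p : X, ∀ U ∈ 𝓝 p, ∃ q ∈ U, q ≠ p) {f : X × X → Y} (hf : Continuous f)
    (hs : Function.Surjective f) (hfib : ∀ x y, f x = f y ↔ x = y ∨ x = y.swap) :
    IsDoubleCoveringBranchedAlong f (Set.diagonal X) := by
  have hswap : ∀ x, f x.swap = f x := fun x => (hfib _ _).mpr (Or.inr rfl)
  have hoff : ∀ x, f x ∉ f '' Set.diagonal X → x.1 ≠ x.2 := fun x hx h => hx ⟨x, h, rfl⟩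
  have hq : Topology.IsQuotientMap f := hf.isClosedMap.isQuotientMap hf hs
  have hopen : IsOpenMap f := by
    intro U hU
    rw [← hq.isOpen_preimage]
    have : f ⁻¹' (f '' U) = U ∪ Prod.swap ⁻¹' U := by
      ext x
      simp only [Set.mem_preimage, Set.mem_image, Set.mem_union]
      constructor
      · rintro ⟨y, hy, h⟩
        rcases (hfib _ _).mp h with rfl | rfl
        · exact Or.inl hy
        · exact Or.inr hy
      · rintro (h | h)
        · exact ⟨x, h, rfl⟩
        · exact ⟨_, h, hswap x⟩
    rw [this]
    exact hU.union (hU.preimage continuous_swap)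
  refine ⟨hf.isProperMap, hs, ?_, ?_, ?_, ?_⟩
  · apply IsCoveringMapOn.of_isLocalHomeomorphOn hf
    rw [isLocalHomeomorphOn_iff_isOpenEmbedding_restrict]
    intro x hx
    -- The exchange carries A × B to B × A, which is disjoint from it, so f is injective on A × B.
    obtain ⟨A, B, hA, hB, hxA, hxB, hAB⟩ := t2_separation (hoff x hx)
    refine ⟨A ×ˢ B, (hA.prod hB).mem_nhds ⟨hxA, hxB⟩, ?_⟩
    refine .of_continuous_injective_isOpenMap (hf.comp continuous_subtype_val) ?_
      (hopen.comp (hA.prod hB).isOpenMap_subtype_val)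
    rintro ⟨y, hy⟩ ⟨z, hz⟩ h
    rcases (hfib _ _).mp h with h | h
    · exact Subtype.ext h
    · exfalso
      subst h
      exact Set.disjoint_left.mp hAB hy.1 hz.2
  · intro y hy
    obtain ⟨x, rfl⟩ := hs y
    have hx := hoff x hy
    have : f ⁻¹' {f x} = {x, x.swap} := by
      ext z
      simp [hfib]
    rw [this, Set.ncard_pair]
    intro h
    exact hx (congrArg Prod.fst h)
  · rintro ⟨p, q⟩ h
    have hpq : p = q := h
    subst hpq
    ext z
    simp [hfib]
  · rintro ⟨p, q⟩ h U hU hinj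
    have hpq : p = q := h
    subst hpq
    obtain ⟨A, hA, B, hB, hAB⟩ := mem_nhds_prod_iff.mp hU
    -- Then (p, r) and (r, p) are distinct points of A × B with the same image.
    obtain ⟨r, hr, hrp⟩ := hX p (A ∩ B) (Filter.inter_mem hA hB)
    have := hinj (hAB ⟨mem_of_mem_nhds hA, hr.2⟩) (hAB ⟨hr.1, mem_of_mem_nhds hB⟩)
      (hswap (r, p))
    exact hrp (congrArg Prod.snd this)

/-! ### Symmetric polynomials of bidegree `(N, N)` are polynomials in the pairing -/

section Invariants

variable {n : ℕ}

/-- The function `f` of `u` and `v` is a homogeneous polynomial of degree `N` in the coordinates of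
`pairing n u v`. -/
def IsPullback (n N : ℕ) (f : (Fin (n - 1) → ℂ) → (Fin (n - 1) → ℂ) → ℂ) : Prop :=
  ∃ P : MvPolynomial (PairIdx n) ℂ, P.IsHomogeneous N ∧ ∀ u v, f u v = eval (pairing n u v) P

theorem IsPullback.add {N : ℕ} {f g : (Fin (n - 1) → ℂ) → (Fin (n - 1) → ℂ) → ℂ}
    (hf : IsPullback n N f) (hg : IsPullback n N g) :
    IsPullback n N (fun u v => f u v + g u v) := by
  obtain ⟨P, hP, h⟩ := hf
  obtain ⟨Q, hQ, h'⟩ := hg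
  exact ⟨P + Q, hP.add hQ, fun u v => by simp only [h, h', map_add]⟩

theorem IsPullback.mul {N M : ℕ} {f g : (Fin (n - 1) → ℂ) → (Fin (n - 1) → ℂ) → ℂ}
    (hf : IsPullback n N f) (hg : IsPullback n M g) :
    IsPullback n (N + M) (fun u v => f u v * g u v) := by
  obtain ⟨P, hP, h⟩ := hf
  obtain ⟨Q, hQ, h'⟩ := hg
  exact ⟨P * Q, hP.mul hQ, fun u v => by simp only [h, h', map_mul]⟩

theorem IsPullback.const_mul {N : ℕ} {f : (Fin (n - 1) → ℂ) → (Fin (n - 1) → ℂ) → ℂ}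
    (hf : IsPullback n N f) (c : ℂ) : IsPullback n N (fun u v => c * f u v) := by
  obtain ⟨P, hP, h⟩ := hf
  exact ⟨C c * P, hP.C_mul c, fun u v => by simp only [h, map_mul, eval_C]⟩

theorem isPullback_zero (N : ℕ) : IsPullback n N (fun _ _ => 0) :=
  ⟨0, isHomogeneous_zero _ _ _, fun _ _ => by simp⟩

theorem isPullback_const (c : ℂ) : IsPullback n 0 (fun _ _ => c) :=
  ⟨C c, isHomogeneous_C _ _, fun _ _ => by simp⟩

theorem isPullback_gram (i j : Fin (n - 1)) :
    IsPullback n 1 (fun u v => u i * v j + u j * v i) :=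
  ⟨gramPoly n i j, isHomogeneous_gramPoly i j, fun u v => (gram_pairing u v i j).symm⟩

/-- The product of two of the antisymmetric functions `u_i v_j - u_j v_i`. -/
theorem isPullback_wedge_mul (i j k l : Fin (n - 1)) :
    IsPullback n 2 (fun u v => (u i * v j - u j * v i) * (u k * v l - u l * v k)) := by
  -- Up to sign, the product is a 2 × 2 minor of u vᵀ + v uᵀ.
  have h := ((isPullback_gram i l).mul (isPullback_gram j k)).add
    (((isPullback_gram i k).mul (isPullback_gram j l)).const_mul (-1))
  convert h using 3
  ring

/-- The symmetrization of `f`, and the products of its antisymmetrization with the functions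
`u_i v_j - u_j v_i`, are homogeneous polynomials in the pairing. -/
structure IsSymmetrizable (n N : ℕ) (f : (Fin (n - 1) → ℂ) → (Fin (n - 1) → ℂ) → ℂ) : Prop where
  symm : IsPullback n N (fun u v => f u v + f v u)
  antisymm : ∀ i j,
    IsPullback n (N + 1) (fun u v => (f u v - f v u) * (u i * v j - u j * v i))

theorem IsSymmetrizable.add {N : ℕ} {f g : (Fin (n - 1) → ℂ) → (Fin (n - 1) → ℂ) → ℂ}
    (hf : IsSymmetrizable n N f) (hg : IsSymmetrizable n N g) :
    IsSymmetrizable n N (fun u v => f u v + g u v) where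
  symm := by
    convert hf.symm.add hg.symm using 3
    ring
  antisymm i j := by
    convert (hf.antisymm i j).add (hg.antisymm i j) using 3
    ring

theorem isSymmetrizable_const (c : ℂ) : IsSymmetrizable n 0 (fun _ _ => c) where
  symm := isPullback_const (c + c)
  antisymm i j := by simpa using isPullback_zero 1

theorem isSymmetrizable_zero (N : ℕ) : IsSymmetrizable n N (fun _ _ => 0) where
  symm := by simpa using isPullback_zero N
  antisymm i j := by simpa using isPullback_zero (N + 1)

/-- Split both f and u_k v_l into symmetric and antisymmetric parts. The symmetric part of the
product contains antisymmetric × antisymmetric, which is the reason for carrying the field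
`antisymm`. That field reproduces itself because a product of two wedges is quadratic in the entries
of S. -/
theorem IsSymmetrizable.mul_mul {N : ℕ} {f : (Fin (n - 1) → ℂ) → (Fin (n - 1) → ℂ) → ℂ}
    (hf : IsSymmetrizable n N f) (k l : Fin (n - 1)) :
    IsSymmetrizable n (N + 1) (fun u v => f u v * (u k * v l)) where
  symm := by
    convert ((hf.symm.mul (isPullback_gram k l)).add (hf.antisymm k l)).const_mul (1 / 2) using 3
    ring
  antisymm i j := by
    convert ((hf.symm.mul (isPullback_wedge_mul k l i j)).add
      ((hf.antisymm i j).mul (isPullback_gram k l))).const_mul (1 / 2) using 3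
    ring

theorem weight_bidegree {ι : Type} [Fintype ι] (d : ι ⊕ ι →₀ ℕ) :
    Finsupp.weight (Sum.elim (fun _ => ((1, 0) : ℕ × ℕ)) (fun _ => (0, 1))) d =
      (∑ i, d (Sum.inl i), ∑ i, d (Sum.inr i)) := by
  rw [Finsupp.weight_apply, Finsupp.sum_fintype _ _ (by simp), Fintype.sum_sum_type]
  ext <;> simp [Prod.fst_sum, Prod.snd_sum]

/-- A monomial of bidegree (N + 1, N + 1) contains some u_k and some v_l; splitting off u_k v_l
leaves bidegree (N, N). -/
theorem isSymmetrizable_monomial (r : ℂ) (N : ℕ) (d : Fin (n - 1) ⊕ Fin (n - 1) →₀ ℕ)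
    (hd : Finsupp.weight (Sum.elim (fun _ => ((1, 0) : ℕ × ℕ)) (fun _ => (0, 1))) d = (N, N)) :
    IsSymmetrizable n N (fun u v => eval (Sum.elim u v) (monomial d r)) := by
  induction N generalizing d with
  | zero =>
    rw [weight_bidegree, Prod.mk.injEq, Finset.sum_eq_zero_iff, Finset.sum_eq_zero_iff] at hd
    have : d = 0 := by
      ext k
      rcases k with k | k
      · exact hd.1 k (Finset.mem_univ k)
      · exact hd.2 k (Finset.mem_univ k)
    subst this
    simpa using isSymmetrizable_const r
  | succ N ih =>
    have hd' := hd
    rw [weight_bidegree, Prod.mk.injEq] at hd'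
    obtain ⟨k, -, hk⟩ := Finset.exists_ne_zero_of_sum_ne_zero (hd'.1.trans_ne N.succ_ne_zero)
    obtain ⟨l, -, hl⟩ := Finset.exists_ne_zero_of_sum_ne_zero (hd'.2.trans_ne N.succ_ne_zero)
    set e : Fin (n - 1) ⊕ Fin (n - 1) →₀ ℕ :=
      Finsupp.single (Sum.inl k) 1 + Finsupp.single (Sum.inr l) 1 with he
    have hle : e ≤ d := by
      intro s
      rcases s with s | s
      · rcases eq_or_ne k s with rfl | h
        · simp [he]; omega
        · simp [he, h]
      · rcases eq_or_ne l s with rfl | h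
        · simp [he]; omega
        · simp [he, h]
    obtain ⟨d', rfl⟩ : ∃ d', d = d' + e := ⟨d - e, (tsub_add_cancel_of_le hle).symm⟩
    have hw : Finsupp.weight (Sum.elim (fun _ => ((1, 0) : ℕ × ℕ)) (fun _ => (0, 1))) e =
        (1, 1) := by
      simp [he, Finsupp.weight_single]
    rw [map_add, hw] at hd
    have h := ih d' (add_right_cancel (b := ((1, 1) : ℕ × ℕ)) hd)
    convert h.mul_mul k l using 3 with u v
    rw [← mul_one r, ← monomial_mul, mul_one, map_mul]
    congr 1
    rw [he, ← mul_one (1 : ℂ), ← monomial_mul, map_mul]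
    simp [eval_monomial]

/-- The first fundamental theorem of invariant theory for `O(2)`: a symmetrized polynomial of
bidegree `(N, N)` is a polynomial of degree `N` in the pairing. -/
theorem IsBihomogeneous.exists_symmetrization_eq
    {F : MvPolynomial (Fin (n - 1) ⊕ Fin (n - 1)) ℂ} {N : ℕ} (hF : IsBihomogeneous F (N, N)) :
    ∃ P : MvPolynomial (PairIdx n) ℂ, P.IsHomogeneous N ∧
      ∀ u v, eval (Sum.elim u v) F + eval (Sum.elim v u) F = eval (pairing n u v) P := by
  have : IsSymmetrizable n N (fun u v => eval (Sum.elim u v) F) := by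
    unfold IsBihomogeneous at hF
    induction hF using IsWeightedHomogeneous.induction_on with
    | zero => simpa using isSymmetrizable_zero N
    | add p q hp hq ihp ihq => simpa using ihp.add ihq
    | monomial d r hr => exact isSymmetrizable_monomial r N d hr
  exact this.symm

end Invariants

/-! ### Bihomogeneous polynomials -/

section Bihomogeneous

variable {ι : Type}

theorem IsBihomogeneous.mul {F G : MvPolynomial (ι ⊕ ι) ℂ} {d e : ℕ × ℕ}
    (hF : IsBihomogeneous F d) (hG : IsBihomogeneous G e) : IsBihomogeneous (F * G) (d + e) :=
  IsWeightedHomogeneous.mul hF hG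

theorem isBihomogeneous_X_inl (i : ι) :
    IsBihomogeneous (X (Sum.inl i) : MvPolynomial (ι ⊕ ι) ℂ) (1, 0) :=
  isWeightedHomogeneous_X ℂ _ (Sum.inl i)

theorem isBihomogeneous_X_inr (i : ι) :
    IsBihomogeneous (X (Sum.inr i) : MvPolynomial (ι ⊕ ι) ℂ) (0, 1) :=
  isWeightedHomogeneous_X ℂ _ (Sum.inr i)

theorem eval_rename_swap (F : MvPolynomial (ι ⊕ ι) ℂ) (u v : ι → ℂ) :
    eval (Sum.elim u v) (rename Sum.swap F) = eval (Sum.elim v u) F := by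
  rw [eval_rename]
  congr 2
  funext k
  rcases k with k | k <;> rfl

theorem IsBihomogeneous.rename_swap {F : MvPolynomial (ι ⊕ ι) ℂ} {d : ℕ × ℕ}
    (hF : IsBihomogeneous F d) : IsBihomogeneous (rename Sum.swap F) d.swap := by
  unfold IsBihomogeneous at hF ⊢
  induction hF using IsWeightedHomogeneous.induction_on with
  | zero => simpa using isWeightedHomogeneous_zero _ _ _
  | add p q hp hq ihp ihq => simpa using ihp.add ihq
  | monomial e r hr =>
    rw [rename_monomial]
    apply isWeightedHomogeneous_monomial
    subst hr
    induction e using Finsupp.induction_linear with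
    | zero => simp
    | add f g hf hg => rw [Finsupp.mapDomain_add, map_add, hf, hg, map_add, Prod.swap_add]
    | single s k =>
      rcases s with s | s <;> simp [Finsupp.mapDomain_single, Finsupp.weight_single]

theorem evalPair_mul (F G : MvPolynomial (ι ⊕ ι) ℂ) (x : ℙ ℂ (ι → ℂ) × ℙ ℂ (ι → ℂ)) :
    evalPair (F * G) x = evalPair F x * evalPair G x := map_mul _ _ _

/-- A bihomogeneous polynomial that does not vanish at a point has a multiple of balanced bidegree
whose symmetrization does not vanish there. -/
theorem exists_mul_symmetrization_ne_zero {G : MvPolynomial (ι ⊕ ι) ℂ} {d : ℕ × ℕ}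
    (hG : IsBihomogeneous G d) {x : ℙ ℂ (ι → ℂ) × ℙ ℂ (ι → ℂ)} (hx : evalPair G x ≠ 0) :
    ∃ (K : MvPolynomial (ι ⊕ ι) ℂ) (e : ℕ × ℕ) (N : ℕ), IsBihomogeneous K e ∧ e + d = (N, N) ∧
      evalPair (K * G) x + evalPair (K * G) x.swap ≠ 0 := by
  obtain ⟨i, hi⟩ := Function.ne_iff.mp x.1.rep_nonzero
  obtain ⟨j, hj⟩ := Function.ne_iff.mp x.2.rep_nonzero
  -- A monomial nonzero at x whose bidegree is that of G reversed, so that M * G is balanced.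
  set M : MvPolynomial (ι ⊕ ι) ℂ := X (Sum.inl i) ^ d.2 * X (Sum.inr j) ^ d.1 with hM
  have hMb : IsBihomogeneous M (d.2, d.1) := by
    have := ((isBihomogeneous_X_inl i).pow d.2).mul ((isBihomogeneous_X_inr j).pow d.1)
    simpa [IsBihomogeneous] using this
  have hMG : evalPair (M * G) x ≠ 0 := by
    rw [evalPair_mul]
    refine mul_ne_zero ?_ hx
    simp only [evalPair, hM, map_mul, map_pow, eval_X, Sum.elim_inl, Sum.elim_inr]
    exact mul_ne_zero (pow_ne_zero _ hi) (pow_ne_zero _ hj)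
  by_cases h : evalPair (M * G) x + evalPair (M * G) x.swap = 0
  · refine ⟨rename Sum.swap (M * G) * M, _, d.2 + d.1 + (d.2 + d.1),
      (hMb.mul hG).rename_swap.mul hMb, ?_, ?_⟩
    · ext <;> simp <;> ring
    · have hs : evalPair (M * G) x.swap ≠ 0 := by
        intro h0
        rw [h0, add_zero] at h
        exact hMG h
      have h1 : ∀ y, evalPair (rename Sum.swap (M * G)) y = evalPair (M * G) y.swap := fun y =>
        eval_rename_swap _ _ _
      rw [mul_assoc, evalPair_mul _ (M * G), evalPair_mul _ (M * G), h1, h1, Prod.swap_swap,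
        mul_comm (evalPair (M * G) x), ← two_mul]
      exact mul_ne_zero two_ne_zero (mul_ne_zero hs hMG)
  · exact ⟨M, _, d.1 + d.2, hMb, by ext <;> simp [add_comm], h⟩

theorem exists_evalPair_ne_zero_subset {U : Set (ℙ ℂ (ι → ℂ) × ℙ ℂ (ι → ℂ))}
    (hU : IsOpen[zariskiTopologyProd ι] U) {x : ℙ ℂ (ι → ℂ) × ℙ ℂ (ι → ℂ)} (hx : x ∈ U) :
    ∃ (G : MvPolynomial (ι ⊕ ι) ℂ) (d : ℕ × ℕ), IsBihomogeneous G d ∧ evalPair G x ≠ 0 ∧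
      ∀ y, evalPair G y ≠ 0 → y ∈ U := by
  induction hU with
  | basic U h =>
    obtain ⟨F, d, hF, rfl⟩ := h
    exact ⟨F, d, hF, hx, fun y hy => hy⟩
  | univ =>
    exact ⟨1, 0, isWeightedHomogeneous_one _ _, by simp [evalPair], fun y _ => Set.mem_univ y⟩
  | inter U V _ _ ihU ihV =>
    obtain ⟨F, d, hF, hFx, hFU⟩ := ihU hx.1
    obtain ⟨G, e, hG, hGx, hGV⟩ := ihV hx.2
    refine ⟨F * G, d + e, hF.mul hG, ?_, fun y hy => ?_⟩
    · rw [evalPair_mul]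
      exact mul_ne_zero hFx hGx
    · rw [evalPair_mul] at hy
      exact ⟨hFU y (left_ne_zero_of_mul hy), hGV y (right_ne_zero_of_mul hy)⟩
  | sUnion S _ ih =>
    obtain ⟨V, hV, hxV⟩ := hx
    obtain ⟨F, d, hF, hFx, hFV⟩ := ih V hV hxV
    exact ⟨F, d, hF, hFx, fun y hy => ⟨V, hV, hFV y hy⟩⟩

end Bihomogeneous

/-! ### The isomorphism of varieties -/

section Iso

variable {n : ℕ}

theorem isBihomogeneous_pairingPoly (k : PairIdx n) : IsBihomogeneous (pairingPoly n k) (1, 1) := by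
  rcases k with i | p
  · exact (isBihomogeneous_X_inl i).mul (isBihomogeneous_X_inr i)
  · exact ((isBihomogeneous_X_inl p.1.1).sub (isBihomogeneous_X_inl p.1.2)).mul
      ((isBihomogeneous_X_inr p.1.1).sub (isBihomogeneous_X_inr p.1.2))

theorem isBihomogeneous_bind₁_pairingPoly {F : MvPolynomial (PairIdx n) ℂ} {N : ℕ}
    (hF : F.IsHomogeneous N) : IsBihomogeneous (bind₁ (pairingPoly n) F) (N, N) := by
  unfold IsHomogeneous at hF
  unfold IsBihomogeneous
  induction hF using IsWeightedHomogeneous.induction_on with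
  | zero => simpa using isWeightedHomogeneous_zero _ _ _
  | add p q hp hq ihp ihq => simpa using ihp.add ihq
  | monomial d r hr =>
    rw [bind₁_monomial]
    refine IsWeightedHomogeneous.C_mul ?_ r
    have := IsWeightedHomogeneous.prod d.support (fun k => pairingPoly n k ^ d k)
      (fun k => d k • ((1, 1) : ℕ × ℕ)) fun k _ => (isBihomogeneous_pairingPoly k).pow (d k)
    have hs : ∑ k ∈ d.support, d k • ((1, 1) : ℕ × ℕ) = (N, N) := by
      rw [← Finset.sum_smul]
      have : ∑ k ∈ d.support, d k = N := by
        rw [← hr, Finsupp.weight_apply, Finsupp.sum]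
        simp
      rw [this]
      simp
    rwa [hs] at this

theorem exists_rep_cmMap (x : ProjSource n × ProjSource n) :
    ∃ a : ℂ, a ≠ 0 ∧ (cmMap n x).rep = a • pairing n x.1.rep x.2.rep := by
  obtain ⟨p, q⟩ := x
  have h : cmMap n (p, q) =
      Projectivization.mk ℂ _ (pairing_ne_zero p.rep_nonzero q.rep_nonzero) := by
    rw [← cmMap_mk p.rep q.rep p.rep_nonzero q.rep_nonzero, Projectivization.mk_rep,
      Projectivization.mk_rep]
  rw [h]
  exact exists_rep_mk _

/-- Values of homogeneous polynomials at `cmMap n x`, up to a factor depending on the degree. -/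
theorem exists_eval_rep_cmMap (x : ProjSource n × ProjSource n) : ∃ a : ℂ, a ≠ 0 ∧
    ∀ (N : ℕ) (P : MvPolynomial (PairIdx n) ℂ), P.IsHomogeneous N →
      eval (cmMap n x).rep P = a ^ N * eval (pairing n x.1.rep x.2.rep) P := by
  obtain ⟨a, ha, h⟩ := exists_rep_cmMap x
  exact ⟨a, ha, fun N P hP => by rw [h, eval_smul_of_isHomogeneous hP]⟩

theorem evalPair_bind₁_pairingPoly (P : MvPolynomial (PairIdx n) ℂ)
    (x : ProjSource n × ProjSource n) :
    evalPair (bind₁ (pairingPoly n) P) x = eval (pairing n x.1.rep x.2.rep) P :=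
  eval_bind₁_pairingPoly _ _ _

theorem eval_rep_cmMap_ne_zero_iff {P : MvPolynomial (PairIdx n) ℂ} {N : ℕ}
    (hP : P.IsHomogeneous N) (x : ProjSource n × ProjSource n) :
    eval (cmMap n x).rep P ≠ 0 ↔ eval (pairing n x.1.rep x.2.rep) P ≠ 0 := by
  obtain ⟨a, ha, h⟩ := exists_eval_rep_cmMap x
  rw [h N P hP]
  simp [ha]

theorem toSym2_swap {X : Type} (x : X × X) : toSym2 x.swap = toSym2 x := Sym2.eq_swap

theorem toSym2_surjective {X : Type} : Function.Surjective (toSym2 (X := X)) := by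
  intro s
  induction s using Sym2.ind with
  | _ p q => exact ⟨(p, q), rfl⟩

/-! ### Zariski topology and regular functions on the quotient -/

theorem continuous_zariski {e : Sym2 (ProjSource n) → cmVariety n}
    (he : ∀ x, (e (toSym2 x) : ProjTarget n) = cmMap n x) :
    @Continuous _ _ (quotTopology (zariskiTopologyProd (Fin (n - 1))))
      (TopologicalSpace.induced Subtype.val (zariskiTopology (PairIdx n))) e := by
  rw [continuous_induced_rng, continuous_coinduced_dom]
  refine continuous_generateFrom_iff.mpr ?_
  rintro _ ⟨F, d, hF, rfl⟩
  refine TopologicalSpace.isOpen_generateFrom_of_mem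
    ⟨bind₁ (pairingPoly n) F, (d, d), isBihomogeneous_bind₁_pairingPoly hF, ?_⟩
  ext x
  simp only [Set.mem_preimage, Function.comp_apply, Set.mem_ofPred_eq, he,
    evalPair_bind₁_pairingPoly]
  exact eval_rep_cmMap_ne_zero_iff hF x

/-- Around x the open set contains the nonvanishing locus of some G. The symmetrization of a
balanced multiple K * G descends to a polynomial P, and where P ≠ 0 the polynomial G is nonzero at z
or at `z.swap`; both represent the same point of the quotient. -/
theorem isOpenMap_zariski {e : Sym2 (ProjSource n) → cmVariety n}
    (he : ∀ x, (e (toSym2 x) : ProjTarget n) = cmMap n x) (hs : Function.Surjective e) :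
    @IsOpenMap _ _ (quotTopology (zariskiTopologyProd (Fin (n - 1))))
      (TopologicalSpace.induced Subtype.val (zariskiTopology (PairIdx n))) e := by
  intro V hV
  have hV' : IsOpen[zariskiTopologyProd (Fin (n - 1))] (toSym2 ⁻¹' V) := hV
  refine (@isOpen_iff_forall_mem_open _
    (TopologicalSpace.induced Subtype.val (zariskiTopology (PairIdx n))) _).mpr ?_
  rintro _ ⟨s, hsV, rfl⟩
  obtain ⟨x, rfl⟩ := toSym2_surjective s
  obtain ⟨G, d, hG, hGx, hGV⟩ := exists_evalPair_ne_zero_subset hV' hsV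
  obtain ⟨K, k, N, hK, hN, hKG⟩ := exists_mul_symmetrization_ne_zero hG hGx
  obtain ⟨P, hP, hPe⟩ := IsBihomogeneous.exists_symmetrization_eq (hN ▸ hK.mul hG)
  refine ⟨Subtype.val ⁻¹' {y | eval y.rep P ≠ 0}, ?_, ?_, ?_⟩
  · intro y hy
    obtain ⟨t, rfl⟩ := hs y
    obtain ⟨z, rfl⟩ := toSym2_surjective t
    refine ⟨_, ?_, rfl⟩
    have hz : eval (cmMap n z).rep P ≠ 0 := by rw [← he]; exact hy
    rw [eval_rep_cmMap_ne_zero_iff hP, ← hPe] at hz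
    by_cases h0 : evalPair G z = 0
    · have h1 : evalPair G z.swap ≠ 0 := by
        intro h1
        apply hz
        change evalPair (K * G) z + evalPair (K * G) z.swap = 0
        rw [evalPair_mul, evalPair_mul, h0, h1, mul_zero, mul_zero, add_zero]
      have := hGV _ h1
      rwa [Set.mem_preimage, toSym2_swap] at this
    · exact hGV z h0
  · exact ⟨_, TopologicalSpace.isOpen_generateFrom_of_mem ⟨P, N, hP, rfl⟩, rfl⟩
  · change eval (e (toSym2 x) : ProjTarget n).rep P ≠ 0
    rw [he, eval_rep_cmMap_ne_zero_iff hP, ← hPe]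
    exact hKG

/-- For descent, a local fraction F / G need not be symmetric. Since f ∘ e is symmetric, it factors
out of the symmetrization of K F G = f · K G G, which presents f as a quotient of two polynomials in
the pairing. -/
theorem isRegularOn_iff {e : Sym2 (ProjSource n) → cmVariety n}
    (he : ∀ x, (e (toSym2 x) : ProjTarget n) = cmMap n x) (hs : Function.Surjective e)
    (U : Set (cmVariety n)) (f : cmVariety n → ℂ) :
    IsRegularOn U f ↔ IsRegularOnQuot (e ⁻¹' U) (f ∘ e) := by
  constructor
  · intro h x hx
    obtain ⟨d, F, G, hF, hG, hGx, hfG⟩ := h (e (toSym2 x)) hx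
    rw [he, eval_rep_cmMap_ne_zero_iff hG] at hGx
    refine ⟨(d, d), _, _, isBihomogeneous_bind₁_pairingPoly hF,
      isBihomogeneous_bind₁_pairingPoly hG, by rwa [evalPair_bind₁_pairingPoly], fun y hy hGy => ?_⟩
    rw [evalPair_bind₁_pairingPoly] at hGy
    rw [evalPair_bind₁_pairingPoly, evalPair_bind₁_pairingPoly]
    have := hfG (e (toSym2 y)) hy (by rwa [he, eval_rep_cmMap_ne_zero_iff hG])
    obtain ⟨a, ha, hae⟩ := exists_eval_rep_cmMap y
    rw [he, hae d F hF, hae d G hG, mul_div_mul_left _ _ (pow_ne_zero d ha)] at this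
    exact this
  · intro h y hy
    obtain ⟨s, rfl⟩ := hs y
    obtain ⟨x, rfl⟩ := toSym2_surjective s
    obtain ⟨d, F, G, hF, hG, hGx, hfG⟩ := h x hy
    -- The extra factor G makes the identity valid also where G vanishes. This is needed because G
    -- may vanish at only one of z and `z.swap`.
    have hFG : ∀ z ∈ toSym2 ⁻¹' (e ⁻¹' U),
        evalPair (F * G) z = f (e (toSym2 z)) * evalPair (G * G) z := by
      intro z hz
      rw [evalPair_mul, evalPair_mul]
      by_cases h0 : evalPair G z = 0
      · rw [h0]; ring
      · have := hfG z hz h0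
        simp only [Function.comp_apply] at this
        rw [this]
        field_simp
    obtain ⟨K, k, N, hK, hN, hKG⟩ := exists_mul_symmetrization_ne_zero (hG.mul hG)
      (x := x) (by rw [evalPair_mul]; exact mul_ne_zero hGx hGx)
    obtain ⟨P, hP, hPe⟩ := IsBihomogeneous.exists_symmetrization_eq (hN ▸ hK.mul (hF.mul hG))
    obtain ⟨Q, hQ, hQe⟩ := IsBihomogeneous.exists_symmetrization_eq (hN ▸ hK.mul (hG.mul hG))
    refine ⟨N, P, Q, hP, hQ, ?_, fun y hy hQy => ?_⟩
    · rw [he, eval_rep_cmMap_ne_zero_iff hQ, ← hQe]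
      exact hKG
    · obtain ⟨s, rfl⟩ := hs y
      obtain ⟨z, rfl⟩ := toSym2_surjective s
      rw [eq_div_iff hQy]
      obtain ⟨a, -, hae⟩ := exists_eval_rep_cmMap z
      rw [he, hae N P hP, hae N Q hQ, ← hPe, ← hQe]
      change _ * (_ * (evalPair (K * (G * G)) z + evalPair (K * (G * G)) z.swap)) =
        _ * (evalPair (K * (F * G)) z + evalPair (K * (F * G)) z.swap)
      have hsw : z.swap ∈ toSym2 ⁻¹' (e ⁻¹' U) := by
        rw [Set.mem_preimage, toSym2_swap]; exact hy
      rw [evalPair_mul K, evalPair_mul K, evalPair_mul K, evalPair_mul K, hFG z hy, hFG _ hsw,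
        toSym2_swap]
      ring

end Iso

end CayleyMenger
end

theorem proposition2p3 (n : ℕ) (hn : 3 ≤ n) :
    -- the Cayley–Menger variety is the image of the map
    Set.range (cmMap n) = cmVariety n ∧
    -- the map onto it is a double covering branched along the diagonal
    ∃ π : ProjSource n × ProjSource n → cmVariety n,
      (∀ x, (π x : ProjTarget n) = cmMap n x) ∧
      IsDoubleCoveringBranchedAlong π (Set.diagonal (ProjSource n)) ∧
      (∀ x, DifferentialInjectiveAt n x ↔ x ∉ Set.diagonal (ProjSource n)) ∧
      -- and it identifies the variety with the quotient by the exchange of the factors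
      ∃ e : Sym2 (ProjSource n) → cmVariety n,
        (∀ x, e (toSym2 x) = π x) ∧
        IsHomeomorph e ∧
        IsIsoOfVarieties e := by
  have hrange := range_cmMap hn
  let π : ProjSource n × ProjSource n → cmVariety n := fun x => ⟨cmMap n x, hrange ▸ ⟨x, rfl⟩⟩
  have hπc : Continuous π := (continuous_cmMap n).subtype_mk _
  have hπs : Function.Surjective π := by
    rintro ⟨y, hy⟩
    obtain ⟨x, rfl⟩ : y ∈ Set.range (cmMap n) := hrange ▸ hy
    exact ⟨x, rfl⟩
  have hπf : ∀ x y, π x = π y ↔ x = y ∨ x = y.swap := fun x y =>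
    Subtype.ext_iff.trans cmMap_eq_iff
  let e : Sym2 (ProjSource n) → cmVariety n :=
    Sym2.lift ⟨fun p q => π (p, q), fun p q => (hπf _ _).mpr (Or.inr rfl)⟩
  have heπ : ∀ x, e (toSym2 x) = π x := fun x => rfl
  have he : ∀ x, (e (toSym2 x) : ProjTarget n) = cmMap n x := fun x => rfl
  have hes : Function.Surjective e := fun y => by
    obtain ⟨x, rfl⟩ := hπs y
    exact ⟨toSym2 x, rfl⟩
  have hei : Function.Injective e := by
    intro s t h
    obtain ⟨x, rfl⟩ := toSym2_surjective s
    obtain ⟨y, rfl⟩ := toSym2_surjective t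
    rcases (hπf x y).mp h with rfl | rfl
    · rfl
    · exact toSym2_swap y
  have hec : Continuous e := continuous_coinduced_dom.mpr hπc
  refine ⟨hrange, π, fun _ => rfl, ?_, differentialInjectiveAt_iff hn, e, heπ, ?_, ?_, ?_⟩
  · exact isDoubleCoveringBranchedAlong_diagonal
      (fun p U hU => exists_ne_mem_of_mem_nhds hn p hU) hπc hπs hπf
  -- A continuous bijection from a compact space to a Hausdorff space.
  · exact isHomeomorph_iff_continuous_bijective.mpr ⟨hec, hei, hes⟩
  · exact @IsHomeomorph.mk _ _ (_) (_) _ (continuous_zariski he) (isOpenMap_zariski he hes)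
      ⟨hei, hes⟩
  · exact fun U _ f => isRegularOn_iff he hes U f
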